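/- Let $(M,g)$ be a connected smooth pseudo-Riemannian manifold of dimension $4$ and signature $(2,2)$, with curvature operator $R(x,y)z$ of the Levi-Civita connection and Weyl curvature operator $W(x,y)z$. Here $W$ is defined by $$R=\tfrac{\mathrm{Scal}}{24}\,g\cdot g+\tfrac12\big(\mathrm{Ric}-\tfrac{\mathrm{Scal}}4 g\big)\cdot g+W,$$ where $R(x,y,z,v)=g(R(x,y)z,v)$ (and likewise for $W$), $\mathrm{Ric}$ is the contraction of $R$ in the first and third slots, $\mathrm{Scal}$ is the contraction of $\mathrm{Ric}$, and $\cdot$ is the Kulkarni–Nomizu product $$(h\cdot k)(x,y,z,v)=h(x,z)k(y,v)+h(y,v)k(x,z)-h(x,v)k(y,z)-h(y,z)k(x,v).$$ For $A\in\{R,W\}$ and a tangent vector $x$ let $J_A(x)y=A(y,x)x$. Call $(M,g)$ *globally Jordan Osserman* (resp. *globally conformally Jordan Osserman*) if the Jordan normal form of $J_R(x)$ (resp. $J_W(x)$) depends neither on the unit timelike tangent vector $x$ (that is, $g(x,x)=-1$) nor on its base point. A *$\mathrm{Cliff}(1,1)$-structure* on an inner product space $(V,g)$ is a triple $(\Phi_1,\Phi_2,\Phi_3)$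 of $g$-skew-adjoint linear operators on $V$ with $\Phi_3=\Phi_2\Phi_1$, $\Phi_1^2=-\mathrm{Id}$, $\Phi_2^2=\Phi_3^2=\mathrm{Id}$ and $\Phi_i\Phi_j+\Phi_j\Phi_i=0$ for $i\ne j$. Put $$R_0(x,y)z=g(x,z)y-g(y,z)x,\qquad R_\Phi(x,y)z=g(\Phi y,z)\Phi x-g(\Phi x,z)\Phi y-2g(\Phi x,y)\Phi z .$$ **Theorem.** 1. If $(M,g)$ is globally Jordan Osserman, then there are real constants $\lambda_0$, $\lambda_i$ $(1\le i\le3)$ and $\lambda_{ij}$ $(1\le i<j\le3)$ such that every point of $M$ has an open neighbourhood carrying a smooth $\mathrm{Cliff}(1,1)$-structure $(\Phi_1,\Phi_2,\Phi_3)$ on its tangent bundle with $$R=\lambda_0R_0+\sum_i\lambda_iR_{\Phi_i}+\sum_{i<j}\lambda_{ij}\big[R_{\Phi_i}+R_{\Phi_j}-R_{(\Phi_i-\Phi_j)}\big]$$ on that neighbourhood. 2. If $(M,g)$ is globally conformally Jordan Osserman, then there are real constants $\lambda_0,\lambda_i,\lambda_{ij}$ with $\lambda_0-\lambda_1+\lambda_2+\lambda_3=0$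 such that every point of $M$ has an open neighbourhood carrying a smooth $\mathrm{Cliff}(1,1)$-structure $(\Phi_1,\Phi_2,\Phi_3)$ on its tangent bundle with $$W=\lambda_0R_0+\sum_i\lambda_iR_{\Phi_i}+\sum_{i<j}\lambda_{ij}\big[R_{\Phi_i}+R_{\Phi_j}-R_{(\Phi_i-\Phi_j)}\big]$$ on that neighbourhood. -/

import Mathlib

open scoped Manifold ContDiff TensorProduct

noncomputable section

namespace Neutral

/-! ## Linear algebra of curvature operators on an inner product space -/

section Algebra

variable {V : Type*} [AddCommGroup V] [Module ℝ V]

/-- A `(1,3)`-tensor, read as a curvature operator `A x y z = A(x,y)z`. -/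
abbrev CurvOp (V : Type*) [AddCommGroup V] [Module ℝ V] : Type _ :=
  V →ₗ[ℝ] V →ₗ[ℝ] V →ₗ[ℝ] V

/-- A `(0,4)`-tensor. -/
abbrev Tensor4 (V : Type*) [AddCommGroup V] [Module ℝ V] : Type _ :=
  V →ₗ[ℝ] V →ₗ[ℝ] V →ₗ[ℝ] V →ₗ[ℝ] ℝ

/-- A symmetric bilinear form `g` of signature `(2,2)`: it admits a pseudo-orthonormal basis
`e₁, e₂, e₃, e₄` with `g(e₁,e₁) = g(e₂,e₂) = -1` and `g(e₃,e₃) = g(e₄,e₄) = 1`. -/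
def HasNeutralSignature (g : LinearMap.BilinForm ℝ V) : Prop :=
  ∃ e : Module.Basis (Fin 4) ℝ V, ∀ i j : Fin 4,
    g (e i) (e j) = if i = j then (![-1, -1, 1, 1] : Fin 4 → ℝ) i else 0

open Classical in
/-- Raising an index: for a nondegenerate `g`, `sharp g φ` is the vector with
`g (sharp g φ) = φ`. (The value `0` for a degenerate `g` is never relevant.) -/
def sharp (g : LinearMap.BilinForm ℝ V) : Module.Dual ℝ V →ₗ[ℝ] V :=
  if h : Function.Bijective g then (LinearEquiv.ofBijective g h).symm else 0

/-- The contraction of a bilinear form `h` with the metric `g`. -/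
def metricTrace (g h : LinearMap.BilinForm ℝ V) : ℝ :=
  LinearMap.trace ℝ V (sharp g ∘ₗ h)

/-- The `(0,4)`-tensor `A(x,y,z,v) = g(A(x,y)z, v)`. -/
def lower (g : LinearMap.BilinForm ℝ V) (A : CurvOp V) : Tensor4 V :=
  LinearMap.mk₂ ℝ (fun x y => g ∘ₗ A x y)
    (fun _ _ _ => by simp [LinearMap.comp_add]) (fun _ _ _ => by simp [LinearMap.comp_smul])
    (fun _ _ _ => by simp [LinearMap.comp_add]) (fun _ _ _ => by simp [LinearMap.comp_smul])

/-- The operator `A(x,y)z` determined by `g(A(x,y)z, v) = A(x,y,z,v)`. -/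
def raise (g : LinearMap.BilinForm ℝ V) (A : Tensor4 V) : CurvOp V :=
  LinearMap.mk₂ ℝ (fun x y => sharp g ∘ₗ A x y)
    (fun _ _ _ => by simp [LinearMap.comp_add]) (fun _ _ _ => by simp [LinearMap.comp_smul])
    (fun _ _ _ => by simp [LinearMap.comp_add]) (fun _ _ _ => by simp [LinearMap.comp_smul])

/-- The bilinear form `(x,z) ↦ A(x,y,z,v)` for fixed `y`, `v`. -/
def slots13 (A : Tensor4 V) (y v : V) : LinearMap.BilinForm ℝ V :=
  LinearMap.mk₂ ℝ (fun x z => A x y z v)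
    (fun _ _ _ => by simp) (fun _ _ _ => by simp) (fun _ _ _ => by simp) (fun _ _ _ => by simp)

/-- The Ricci tensor: the contraction of `A` in the first and the third slot. -/
def ricci (g : LinearMap.BilinForm ℝ V) (A : Tensor4 V) : LinearMap.BilinForm ℝ V :=
  LinearMap.mk₂ ℝ (fun y v => metricTrace g (slots13 A y v))
    (fun y y' v => by
      have h : slots13 A (y + y') v = slots13 A y v + slots13 A y' v := by
        ext; simp [slots13]
      simp [h, metricTrace, LinearMap.comp_add])
    (fun c y v => by
      have h : slots13 A (c • y) v = c • slots13 A y v := by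
        ext; simp [slots13]
      simp [h, metricTrace, LinearMap.comp_smul])
    (fun y v v' => by
      have h : slots13 A y (v + v') = slots13 A y v + slots13 A y v' := by
        ext; simp [slots13]
      simp [h, metricTrace, LinearMap.comp_add])
    (fun c y v => by
      have h : slots13 A y (c • v) = c • slots13 A y v := by
        ext; simp [slots13]
      simp [h, metricTrace, LinearMap.comp_smul])

/-- The scalar curvature. -/
def scal (g : LinearMap.BilinForm ℝ V) (A : Tensor4 V) : ℝ :=
  metricTrace g (ricci g A)

/-- The Kulkarni-Nomizu product
`h(x,z) k(y,v) + h(y,v) k(x,z) - h(x,v) k(y,z) - h(y,z) k(x,v)`. -/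
def kulkarniNomizu (h k : LinearMap.BilinForm ℝ V) : Tensor4 V :=
  LinearMap.mk₂ ℝ
    (fun x y => LinearMap.mk₂ ℝ
      (fun z v => h x z * k y v + h y v * k x z - h x v * k y z - h y z * k x v)
      (fun _ _ _ => by simp; ring) (fun _ _ _ => by simp; ring)
      (fun _ _ _ => by simp; ring) (fun _ _ _ => by simp; ring))
    (fun _ _ _ => by ext; simp; ring) (fun _ _ _ => by ext; simp; ring)
    (fun _ _ _ => by ext; simp; ring) (fun _ _ _ => by ext; simp; ring)

/-- The Weyl tensor in dimension four, as a `(0,4)`-tensor: the `W` in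
`A = Scal/24 g·g + 1/2 (Ric - Scal/4 g)·g + W`. -/
def weyl4 (g : LinearMap.BilinForm ℝ V) (A : Tensor4 V) : Tensor4 V :=
  LinearMap.mk₂ ℝ
    (fun x y => A x y - (scal g A / 24) • kulkarniNomizu g g x y
      - (1 / 2 : ℝ) • kulkarniNomizu (ricci g A - (scal g A / 4) • g) g x y)
    (fun _ _ _ => by ext; simp; ring) (fun _ _ _ => by ext; simp; ring)
    (fun _ _ _ => by ext; simp; ring) (fun _ _ _ => by ext; simp; ring)

/-- The Weyl curvature operator of a curvature operator, in dimension four. -/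
def weylOp (g : LinearMap.BilinForm ℝ V) (A : CurvOp V) : CurvOp V :=
  raise g (weyl4 g (lower g A))

/-- The Jacobi operator `J_A(x) : y ↦ A(y,x)x`. -/
def jacobiOp (A : CurvOp V) (x : V) : V →ₗ[ℝ] V := (A.flip x).flip x

/-- Matrices in (complex) Jordan normal form: upper bidiagonal, each superdiagonal entry being
`0`, or `1` between two equal diagonal entries. -/
def IsJordanMatrix {n : ℕ} (N : Matrix (Fin n) (Fin n) ℂ) : Prop :=
  ∀ i j : Fin n,
    (j ≠ i → (j : ℕ) ≠ i + 1 → N i j = 0) ∧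
    ((j : ℕ) = i + 1 → N i j = 0 ∨ (N i j = 1 ∧ N i i = N j j))

/-- The real endomorphism `T` has the Jordan normal form `N`: the complexification of `T` is
represented by the Jordan matrix `N` in some basis. -/
def HasJordanNormalForm {n : ℕ} (T : V →ₗ[ℝ] V) (N : Matrix (Fin n) (Fin n) ℂ) : Prop :=
  IsJordanMatrix N ∧
    ∃ b : Module.Basis (Fin n) ℂ (ℂ ⊗[ℝ] V), LinearMap.toMatrix b b (T.baseChange ℂ) = N

/-- `R₀(x,y)z = g(x,z)y - g(y,z)x`. -/
def R₀ (g : LinearMap.BilinForm ℝ V) (x y z : V) : V := g x z • y - g y z • x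

/-- `R_Φ(x,y)z = g(Φy,z)Φx - g(Φx,z)Φy - 2g(Φx,y)Φz`. -/
def RΦ (g : LinearMap.BilinForm ℝ V) (Φ : V →ₗ[ℝ] V) (x y z : V) : V :=
  g (Φ y) z • Φ x - g (Φ x) z • Φ y - (2 * g (Φ x) y) • Φ z

/-- `Cliff(1,1)`-structures `(Φ₁, Φ₂, Φ₃)` on `(V,g)`; here `Φᵢ₊₁` is written `Φ i`. -/
structure IsCliff11Structure (g : LinearMap.BilinForm ℝ V) (Φ : Fin 3 → V →ₗ[ℝ] V) : Prop where
  skew : ∀ i x y, g (Φ i x) y = -g x (Φ i y)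
  sq_one : Φ 0 ∘ₗ Φ 0 = -LinearMap.id
  sq_two : Φ 1 ∘ₗ Φ 1 = LinearMap.id
  sq_three : Φ 2 ∘ₗ Φ 2 = LinearMap.id
  anticomm : ∀ i j, i ≠ j → Φ i ∘ₗ Φ j + Φ j ∘ₗ Φ i = 0
  three_eq : Φ 2 = Φ 1 ∘ₗ Φ 0

/-- `λ₀ R₀ + ∑ᵢ λᵢ R_{Φᵢ} + ∑_{i<j} λᵢⱼ [R_{Φᵢ} + R_{Φⱼ} - R_{Φᵢ-Φⱼ}]`, evaluated at `(x,y)z`. -/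
def modifiedClifford (g : LinearMap.BilinForm ℝ V) (Φ : Fin 3 → V →ₗ[ℝ] V)
    (l₀ : ℝ) (l : Fin 3 → ℝ) (m : Fin 3 → Fin 3 → ℝ) (x y z : V) : V :=
  l₀ • R₀ g x y z + ∑ i, l i • RΦ g (Φ i) x y z
    + ∑ i, ∑ j ∈ Finset.Ioi i,
        m i j • (RΦ g (Φ i) x y z + RΦ g (Φ j) x y z - RΦ g (Φ i - Φ j) x y z)

end Algebra

/-! ## Pseudo-Riemannian manifolds of signature `(2,2)` -/

/-- The model space of a four-dimensional manifold. -/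
abbrev E4 : Type := EuclideanSpace ℝ (Fin 4)

section Manifold

variable {M : Type*} [TopologicalSpace M] [ChartedSpace E4 M]

variable (M) in
/-- A smooth pseudo-Riemannian metric of signature `(2,2)` on a four-dimensional manifold. -/
structure NeutralMetric [IsManifold (𝓡 4) ∞ M] where
  /-- The inner product on each tangent space. -/
  val : ∀ p : M, TangentSpace (𝓡 4) p →L[ℝ] TangentSpace (𝓡 4) p →L[ℝ] ℝ
  symm : ∀ (p : M) (v w : TangentSpace (𝓡 4) p), val p v w = val p w v
  signature : ∀ p : M, HasNeutralSignature (val p).toLinearMap₁₂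
  contMDiff : ContMDiff (𝓡 4) ((𝓡 4).prod 𝓘(ℝ, E4 →L[ℝ] E4 →L[ℝ] ℝ)) ∞
    (fun p => Bundle.TotalSpace.mk' (E4 →L[ℝ] E4 →L[ℝ] ℝ)
      (E := fun p : M => TangentSpace (𝓡 4) p →L[ℝ] TangentSpace (𝓡 4) p →L[ℝ] ℝ) p (val p))

variable [IsManifold (𝓡 4) ∞ M]

/-- The inner product on `T_pM` as a bilinear form. -/
def NeutralMetric.form (g : NeutralMetric M) (p : M) :
    LinearMap.BilinForm ℝ (TangentSpace (𝓡 4) p) :=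
  (g.val p).toLinearMap₁₂

/-- The differential `dφ⁻¹` at `u` of the inverse of the preferred chart `φ` around `p`. -/
def coordFrame (p : M) (u : E4) :
    E4 →ₗ[ℝ] TangentSpace (𝓡 4) ((extChartAt (𝓡 4) p).symm u) :=
  (mfderiv 𝓘(ℝ, E4) (𝓡 4) (extChartAt (𝓡 4) p).symm u).toLinearMap

/-- The metric in the preferred coordinates `φ` around `p`: at a point `u` of the coordinate
domain this is the bilinear form `(v,w) ↦ g(dφ⁻¹ v, dφ⁻¹ w)`, whose values on the standard basis
are the components `g_ij(u)`. -/
def coordMetric (g : NeutralMetric M) (p : M) (u : E4) : E4 →L[ℝ] E4 →L[ℝ] ℝ :=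
  LinearMap.toContinuousBilinearMap
    ((g.form ((extChartAt (𝓡 4) p).symm u)).compl₁₂ (coordFrame p u) (coordFrame p u))

/-- The Christoffel symbols of the first kind of a field `G` of bilinear forms on `ℝ⁴`:
`1/2 (∂_v G(w,z) + ∂_w G(v,z) - ∂_z G(v,w))`, as a linear form in `z`. -/
def christoffelLower (G : E4 → E4 →L[ℝ] E4 →L[ℝ] ℝ) (u v w : E4) : Module.Dual ℝ E4 :=
  (1 / 2 : ℝ) • ((fderiv ℝ G u v w : E4 →ₗ[ℝ] ℝ) + (fderiv ℝ G u w v : E4 →ₗ[ℝ] ℝ)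
    - (((fderiv ℝ G u).flip v).flip w : E4 →ₗ[ℝ] ℝ))

/-- The Christoffel symbols `Γ(v,w)` of the Levi-Civita connection of `G`, so that
`∇_v w = ∂_v w + Γ(v,w)`. -/
def christoffel (G : E4 → E4 →L[ℝ] E4 →L[ℝ] ℝ) (u : E4) : E4 →L[ℝ] E4 →L[ℝ] E4 :=
  LinearMap.toContinuousBilinearMap
    (LinearMap.mk₂ ℝ (fun v w => sharp (G u).toLinearMap₁₂ (christoffelLower G u v w))
      (fun _ _ _ => by
        rw [← map_add]; congr 1; ext; simp [christoffelLower]; ring)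
      (fun _ _ _ => by
        rw [← map_smul]; congr 1; ext; simp [christoffelLower]; ring)
      (fun _ _ _ => by
        rw [← map_add]; congr 1; ext; simp [christoffelLower]; ring)
      (fun _ _ _ => by
        rw [← map_smul]; congr 1; ext; simp [christoffelLower]; ring))

/-- The curvature operator, at `u`, of the connection with Christoffel symbols `Γ`:
`R(v,w)z = (∂_v Γ)(w,z) - (∂_w Γ)(v,z) + Γ(v,Γ(w,z)) - Γ(w,Γ(v,z))`. -/
def coordCurvature (Γ : E4 → E4 →L[ℝ] E4 →L[ℝ] E4) (u : E4) : CurvOp E4 :=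
  LinearMap.mk₂ ℝ
    (fun v w => ((fderiv ℝ Γ u v w - fderiv ℝ Γ u w v
      + (Γ u v) ∘L (Γ u w) - (Γ u w) ∘L (Γ u v) : E4 →L[ℝ] E4) : E4 →ₗ[ℝ] E4))
    (fun _ _ _ => by ext1; simp; abel)
    (fun _ _ _ => by ext1; simp [smul_sub, smul_add])
    (fun _ _ _ => by ext1; simp; abel)
    (fun _ _ _ => by ext1; simp [smul_sub, smul_add])

/-- The curvature operator `R(x,y)z` of the Levi-Civita connection at `p`, computed in the
preferred coordinates around `p`. These identify `T_pM` with the model space `ℝ⁴`; in Mathlib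
this identification is the definition of `T_pM`. -/
def curvature (g : NeutralMetric M) (p : M) : CurvOp (TangentSpace (𝓡 4) p) :=
  coordCurvature (christoffel (coordMetric g p)) (extChartAt (𝓡 4) p p)

/-- The Weyl curvature operator `W(x,y)z` at `p`. -/
def weylCurvature (g : NeutralMetric M) (p : M) : CurvOp (TangentSpace (𝓡 4) p) :=
  weylOp (g.form p) (curvature g p)

/-- The Jordan normal form of the Jacobi operator `J_A(x)` depends neither on the base point nor
on the unit timelike tangent vector `x`. -/
def JordanFormIndependent (g : NeutralMetric M)
    (A : ∀ p : M, CurvOp (TangentSpace (𝓡 4) p)) : Prop :=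
  ∃ N : Matrix (Fin 4) (Fin 4) ℂ, ∀ (p : M) (x : TangentSpace (𝓡 4) p),
    g.form p x x = -1 → HasJordanNormalForm (jacobiOp (A p) x) N

/-- Globally Jordan Osserman. -/
def GloballyJordanOsserman (g : NeutralMetric M) : Prop :=
  JordanFormIndependent g (curvature g)

/-- Globally conformally Jordan Osserman. -/
def GloballyConformallyJordanOsserman (g : NeutralMetric M) : Prop :=
  JordanFormIndependent g (weylCurvature g)

/-- A family `Φ` of endomorphisms of the tangent spaces is a smooth `Cliff(1,1)`-structure over
the set `U`. -/
def IsSmoothCliff11StructureOn (g : NeutralMetric M) (U : Set M)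
    (Φ : Fin 3 → ∀ p : M, TangentSpace (𝓡 4) p →L[ℝ] TangentSpace (𝓡 4) p) : Prop :=
  (∀ i, ContMDiffOn (𝓡 4) ((𝓡 4).prod 𝓘(ℝ, E4 →L[ℝ] E4)) ∞
    (fun p => Bundle.TotalSpace.mk' (E4 →L[ℝ] E4)
      (E := fun p : M => TangentSpace (𝓡 4) p →L[ℝ] TangentSpace (𝓡 4) p) p (Φ i p)) U) ∧
  ∀ p ∈ U, IsCliff11Structure (g.form p) (fun i => (Φ i p).toLinearMap)

/-- Near each point there is a smooth `Cliff(1,1)`-structure in terms of which `A` is the modified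
Clifford tensor with the constant coefficients `l₀`, `l i`, `m i j`. -/
def HasConstantCliffordDecomposition (g : NeutralMetric M)
    (A : ∀ p : M, CurvOp (TangentSpace (𝓡 4) p))
    (l₀ : ℝ) (l : Fin 3 → ℝ) (m : Fin 3 → Fin 3 → ℝ) : Prop :=
  ∀ P : M, ∃ U : Set M, IsOpen U ∧ P ∈ U ∧
    ∃ Φ : Fin 3 → ∀ p : M, TangentSpace (𝓡 4) p →L[ℝ] TangentSpace (𝓡 4) p,
      IsSmoothCliff11StructureOn g U Φ ∧
      ∀ p ∈ U, ∀ x y z : TangentSpace (𝓡 4) p,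
        A p x y z =
          modifiedClifford (g.form p) (fun i => (Φ i p).toLinearMap) l₀ l m x y z

end Manifold

end Neutral

end

noncomputable section

open Filter Topology
open scoped Matrix.Norms.Operator

namespace Neutral

/-! ## Germs of smooth maps -/

section SmoothNear

variable {E F F' F'' : Type*} [NormedAddCommGroup E] [NormedSpace ℝ E]
  [NormedAddCommGroup F] [NormedSpace ℝ F] [NormedAddCommGroup F'] [NormedSpace ℝ F']
  [NormedAddCommGroup F''] [NormedSpace ℝ F'']

/-! Similar operators have equal traces, and so do their squares; hence tr J(x) and tr J(x)² are
constant on unit timelike vectors x. In an orthonormal frame, tr J(x) is minus the Ricci form, so by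
homogeneity the Ricci form is a multiple of g on the timelike cone, and the tensor is Einstein
(`isEinsteinComp_of_trace`). Likewise tr J(x)² is a multiple of g(x,x)² on that cone, and by
continuity it vanishes on null vectors (`eq_zero_of_null`). In signature (2,2) a null vector is a
rank-one 2×2 matrix, a product of two spinors (s,t) and (p,q). For an Einstein tensor tr J² factors
there into a quartic in (s,t) times a quartic in (p,q), one for each half of the Weyl tensor
(`trace_jac_sq_null`). One quartic must vanish identically, so the tensor is Einstein and half
conformally flat (`exists_isHalfFlat`).

For a fixed orientation such tensors have six free components. They are matched by the three R_Φ and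
the three mixed terms of a Cliff(1,1)-structure with constant matrices in the frame
(`IsHalfFlat.eq_cliffComp`). Since R₀ is itself of this type, λ₀ = 0 suffices. The same six
components are those of the Jacobi operator at the first frame vector, which therefore determines
the tensor (`IsHalfFlat.eq_of_jac_eq`).

It remains to find smooth orthonormal frames in which the components are constant. The matrices J(y)
of the Jacobi operator at the first vector of any smooth orthonormal frame are self-adjoint and all
similar. The intertwiners between J(y) and J(x) are then kernels of constant dimension, so the
identity extends to a smooth intertwiner L (`SmoothNear.exists_intertwiner`). Its pseudo-orthogonal
polar factor L(L*L)^(-1/2) still intertwines, and it rotates the frame so that J becomes constant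
(`exists_smooth_conjugation`); the orientation cannot jump because half flatness is a closed
condition (`JordanFormIndependent.exists_frameField`). Hence the set of points admitting a frame
with prescribed components is open. Two such sets are equal or disjoint, so by connectedness one set
of components serves all of M (`JordanFormIndependent.modelSet_eq_univ`).

The curvature is defined at each point in the chart preferred there; naturality under coordinate
changes (`coordCurvature_naturality`) allows a whole neighbourhood to be treated in a single chart.
For the Weyl tensor the linear relation between the coefficients is the vanishing of one Ricci
component. -/

/-- The map `f` is smooth on a neighbourhood of `x`. -/
def SmoothNear (f : E → F) (x : E) : Prop := ∀ᶠ y in 𝓝 x, ContDiffAt ℝ ∞ f y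

lemma SmoothNear.contDiffAt {f : E → F} {x : E} (h : SmoothNear f x) : ContDiffAt ℝ ∞ f x :=
  h.self_of_nhds

lemma SmoothNear.continuousAt {f : E → F} {x : E} (h : SmoothNear f x) : ContinuousAt f x :=
  h.contDiffAt.continuousAt

/-- Being C^∞ at a point gives a neighbourhood for each finite order only, so it need not persist
nearby. Analyticity does persist, which is why the inverse function theorem and ring inversion enter
through `ω`. -/
lemma smoothNear_of_contDiffAt {f : E → F} {x : E} (h : ContDiffAt ℝ ω f x) : SmoothNear f x :=
  (h.eventually (by simp)).mono fun _ hy => hy.of_le (by simp)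

lemma smoothNear_of_contDiff {f : E → F} (h : ContDiff ℝ ∞ f) (x : E) : SmoothNear f x :=
  Eventually.of_forall fun _ => h.contDiffAt

lemma smoothNear_const (c : F) (x : E) : SmoothNear (fun _ : E => c) x :=
  smoothNear_of_contDiff contDiff_const x

lemma SmoothNear.comp {f : F → F'} {g : E → F} {x : E} (hf : SmoothNear f (g x))
    (hg : SmoothNear g x) : SmoothNear (fun y => f (g y)) x := by
  filter_upwards [hg.continuousAt.eventually hf, hg] with y h1 h2
  exact h1.comp y h2

lemma SmoothNear.congr {f g : E → F} {x : E} (hf : SmoothNear f x) (h : ∀ᶠ y in 𝓝 x, g y = f y) :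
    SmoothNear g x := by
  filter_upwards [hf, eventually_eventually_nhds.2 h] with y h1 h2
  exact h1.congr_of_eventuallyEq h2

lemma SmoothNear.add {f g : E → F} {x : E} (hf : SmoothNear f x) (hg : SmoothNear g x) :
    SmoothNear (fun y => f y + g y) x := by
  filter_upwards [hf, hg] with y h1 h2 using h1.add h2

lemma SmoothNear.sub {f g : E → F} {x : E} (hf : SmoothNear f x) (hg : SmoothNear g x) :
    SmoothNear (fun y => f y - g y) x := by
  filter_upwards [hf, hg] with y h1 h2 using h1.sub h2

lemma SmoothNear.smul {f : E → ℝ} {g : E → F} {x : E} (hf : SmoothNear f x)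
    (hg : SmoothNear g x) : SmoothNear (fun y => f y • g y) x := by
  filter_upwards [hf, hg] with y h1 h2 using h1.smul h2

lemma SmoothNear.mul {A : Type*} [NormedRing A] [NormedAlgebra ℝ A] {f g : E → A} {x : E}
    (hf : SmoothNear f x) (hg : SmoothNear g x) : SmoothNear (fun y => f y * g y) x := by
  filter_upwards [hf, hg] with y h1 h2 using h1.mul h2

lemma SmoothNear.clm (L : F →L[ℝ] F') {g : E → F} {x : E} (hg : SmoothNear g x) :
    SmoothNear (fun y => L (g y)) x :=
  (smoothNear_of_contDiff L.contDiff _).comp hg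

lemma SmoothNear.linear [FiniteDimensional ℝ F] (L : F →ₗ[ℝ] F') {g : E → F} {x : E}
    (hg : SmoothNear g x) : SmoothNear (fun y => L (g y)) x :=
  hg.clm (LinearMap.toContinuousLinearMap L)

lemma SmoothNear.clm_apply {f : E → F →L[ℝ] F'} {g : E → F} {x : E}
    (hf : SmoothNear f x) (hg : SmoothNear g x) : SmoothNear (fun y => f y (g y)) x := by
  filter_upwards [hf, hg] with y h1 h2 using h1.clm_apply h2

lemma SmoothNear.clm_comp {f : E → F' →L[ℝ] F''} {g : E → F →L[ℝ] F'} {x : E}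
    (hf : SmoothNear f x) (hg : SmoothNear g x) : SmoothNear (fun y => (f y).comp (g y)) x := by
  filter_upwards [hf, hg] with y h1 h2 using h1.clm_comp h2

lemma SmoothNear.sum {ι : Type*} {s : Finset ι} {f : ι → E → F} {x : E}
    (hf : ∀ i ∈ s, SmoothNear (f i) x) : SmoothNear (fun y => ∑ i ∈ s, f i y) x := by
  have := (s.eventually_all).2 hf
  filter_upwards [this] with y h1 using ContDiffAt.sum h1

lemma SmoothNear.fderiv {f : E → F} {x : E} (hf : SmoothNear f x) :
    SmoothNear (fderiv ℝ f) x :=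
  hf.mono fun _ h => h.fderiv_right (m := ∞) (by simp)

lemma SmoothNear.ringInverse {A : Type*} [NormedRing A] [NormedAlgebra ℝ A] [CompleteSpace A]
    {f : E → A} {x : E} (hf : SmoothNear f x) (h : IsUnit (f x)) :
    SmoothNear (fun y => Ring.inverse (f y)) x := by
  obtain ⟨a, ha⟩ := h
  refine SmoothNear.comp (f := Ring.inverse) (smoothNear_of_contDiffAt ?_) hf
  rw [← ha]
  exact contDiffAt_ringInverse ℝ a

lemma smoothNear_matrix {m n : Type*} [Fintype m] [Fintype n] [DecidableEq m] [DecidableEq n]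
    {f : E → Matrix m n ℝ} {x : E} :
    SmoothNear f x ↔ ∀ i j, SmoothNear (fun y => f y i j) x := by
  constructor
  · intro h i j
    exact h.linear (Matrix.entryLinearMap ℝ ℝ i j)
  · intro h
    have : f = fun y => ∑ i, ∑ j, f y i j • Matrix.single i j (1 : ℝ) := by
      funext y
      conv_lhs => rw [Matrix.matrix_eq_sum_single (f y)]
      simp
    rw [this]
    exact SmoothNear.sum fun i _ => SmoothNear.sum fun j _ => (h i j).smul (smoothNear_const _ _)

end SmoothNear

/-! ## Square roots near the identity -/

section Sqrt

variable {E A : Type*} [NormedAddCommGroup E] [NormedSpace ℝ E]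
  [NormedRing A] [NormedAlgebra ℝ A] [CompleteSpace A]

variable (A) in
-- Inverse function theorem for squaring at 1, whose derivative there is multiplication by 2. The
-- last clause is the local uniqueness of the root, from which all its symmetries are deduced.
lemma exists_local_sqrt : ∃ σ : A → A, σ 1 = 1 ∧ SmoothNear σ 1 ∧
    (∀ᶠ x in 𝓝 (1 : A), σ x * σ x = x) ∧ ∀ᶠ q in 𝓝 (1 : A), σ (q * q) = q := by
  have hf : ContDiffAt ℝ ω (fun x : A => x * x) 1 := by fun_prop
  let e : A ≃L[ℝ] A := ContinuousLinearEquiv.smulLeft (Units.mk0 (2 : ℝ) two_ne_zero)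
  have hf' : HasFDerivAt (fun x : A => x * x) (e : A →L[ℝ] A) 1 := by
    have := (hasFDerivAt_id (𝕜 := ℝ) (1 : A)).mul' (hasFDerivAt_id (𝕜 := ℝ) (1 : A))
    have he : (e : A →L[ℝ] A) = id (1 : A) • ContinuousLinearMap.id ℝ A +
        MulOpposite.op (id (1 : A)) • ContinuousLinearMap.id ℝ A := by
      ext x
      simp [e, two_smul, Units.smul_def]
    rw [he]
    exact this
  have hs := hf.hasStrictFDerivAt' hf' (by simp)
  refine ⟨hf.localInverse hf' (by simp), ?_, ?_, ?_, ?_⟩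
  · simpa using hf.localInverse_apply_image hf' (by simp)
  · have := hf.to_localInverse hf' (by simp)
    rw [mul_one] at this
    exact smoothNear_of_contDiffAt this
  · have := hs.eventually_right_inverse
    rw [mul_one] at this
    exact this
  · exact hs.eventually_left_inverse

/-- The square root of a family `X` near `1` inherits the symmetries of `X`. -/
lemma SmoothNear.exists_sqrt {X : E → A} {x : E} (hX : SmoothNear X x) (h1 : X x = 1) :
    ∃ q : E → A, SmoothNear q x ∧ q x = 1 ∧ (∀ᶠ y in 𝓝 x, q y * q y = X y) ∧
      ∀ θ : A → A, ContinuousAt θ 1 → θ 1 = 1 → (∀ a, θ (a * a) = θ a * θ a) →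
        ∀ᶠ y in 𝓝 x, θ (X y) = X y → θ (q y) = q y := by
  obtain ⟨σ, hσ1, hσ, hσr, hσl⟩ := exists_local_sqrt A
  have hq : SmoothNear (fun y => σ (X y)) x := SmoothNear.comp (by rwa [h1]) hX
  have hXc : Tendsto X (𝓝 x) (𝓝 1) := by simpa [h1] using hX.continuousAt.tendsto
  refine ⟨fun y => σ (X y), hq, by simp [h1, hσ1], hXc.eventually hσr, ?_⟩
  intro θ hθ hθ1 hm
  have hqc : Tendsto (fun y => σ (X y)) (𝓝 x) (𝓝 1) := by
    simpa [h1, hσ1] using hq.continuousAt.tendsto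
  have hθq : Tendsto (fun y => θ (σ (X y))) (𝓝 x) (𝓝 1) := by
    have := hθ.tendsto.comp hqc
    rwa [hθ1] at this
  -- Both `q` and `θ q` are close to 1, and both square to `X`; local uniqueness identifies them.
  -- Only the action of `θ` on squares is used, so automorphisms and anti-automorphisms are both
  -- covered.
  filter_upwards [hθq.eventually hσl, hXc.eventually hσr] with y h2 h3 h4
  rw [← hm, h3, h4] at h2
  exact h2.symm

/-- Replaces an arbitrary `B` by a unit with the same commutant, so that commuting with `B` becomes
invariance under a conjugation. -/
lemma exists_isUnit_one_add_smul (B : A) : ∃ ε : ℝ, ε ≠ 0 ∧ IsUnit (1 + ε • B) := by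
  have hc : ContinuousAt (fun ε : ℝ => 1 + ε • B) 0 := by fun_prop
  have : ∀ᶠ ε in 𝓝 (0 : ℝ), IsUnit (1 + ε • B) :=
    hc.eventually (Units.isOpen.mem_nhds (by simp))
  have h2 : ∀ᶠ ε in 𝓝[≠] (0 : ℝ), ε ≠ 0 ∧ IsUnit (1 + ε • B) :=
    (eventually_mem_nhdsWithin).and (this.filter_mono nhdsWithin_le_nhds)
  exact h2.exists

/-- A version of `SmoothNear.exists_sqrt` for an anti-automorphism `θ` and commutants. -/
lemma SmoothNear.exists_sqrt_comm {X : E → A} {x : E} (hX : SmoothNear X x) (h1 : X x = 1)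
    (θ : A → A) (hθ : Continuous θ) (hθ1 : θ 1 = 1) (hθm : ∀ a b, θ (a * b) = θ b * θ a)
    (hθX : ∀ᶠ y in 𝓝 x, θ (X y) = X y) :
    ∃ q : E → A, SmoothNear q x ∧ q x = 1 ∧ (∀ᶠ y in 𝓝 x, q y * q y = X y) ∧
      (∀ᶠ y in 𝓝 x, θ (q y) = q y) ∧
      ∀ B : A, (∀ᶠ y in 𝓝 x, Commute B (X y)) → ∀ᶠ y in 𝓝 x, Commute B (q y) := by
  obtain ⟨q, h2, h3, h4, h5⟩ := hX.exists_sqrt h1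
  refine ⟨q, h2, h3, h4, ?_, ?_⟩
  · filter_upwards [h5 θ hθ.continuousAt hθ1 fun a => hθm a a, hθX] with y h6 h7 using h6 h7
  · intro B hB
    obtain ⟨ε, hε, b, hb⟩ := exists_isUnit_one_add_smul B
    have hcomm : ∀ a : A, Commute B a ↔ (b : A) * a * (↑b⁻¹ : A) = a := by
      intro a
      rw [Units.mul_inv_eq_iff_eq_mul, hb]
      constructor
      · intro h
        rw [add_mul, mul_add, smul_mul_assoc, mul_smul_comm, h.eq]; simp
      · intro h
        rw [add_mul, mul_add, smul_mul_assoc, mul_smul_comm] at h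
        simp only [one_mul, mul_one, add_right_inj] at h
        exact smul_right_injective A hε h
    have := h5 (fun a => (b : A) * a * (↑b⁻¹ : A)) (by fun_prop) (by simp)
      (fun a => by simp [mul_assoc])
    filter_upwards [this, hB] with y h6 h7
    exact (hcomm _).2 (h6 ((hcomm _).1 h7))

end Sqrt

/-! ## Kernels of constant rank -/

section Kernel

variable {E W W' : Type*} [NormedAddCommGroup E] [NormedSpace ℝ E]
  [NormedAddCommGroup W] [NormedSpace ℝ W] [FiniteDimensional ℝ W]
  [NormedAddCommGroup W'] [NormedSpace ℝ W'] [FiniteDimensional ℝ W']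

omit [FiniteDimensional ℝ W'] in
-- `B` is a projection onto the range of `K` followed by a section of `K` over its range.
lemma exists_generalized_inverse (K : W →ₗ[ℝ] W') :
    ∃ B : W' →ₗ[ℝ] W, K ∘ₗ B ∘ₗ K = K ∧ B ∘ₗ K ∘ₗ B = B := by
  obtain ⟨f, hf⟩ := LinearMap.exists_rightInverse_of_surjective K.rangeRestrict
    K.range_rangeRestrict
  obtain ⟨p, hp⟩ := LinearMap.exists_leftInverse_of_injective (LinearMap.range K).subtype
    (Submodule.ker_subtype _)
  have hf' : ∀ w, K (f w) = w := fun w => congrArg Subtype.val (LinearMap.congr_fun hf w)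
  have hp' : ∀ w : LinearMap.range K, p (w : W') = w := fun w => LinearMap.congr_fun hp w
  refine ⟨f ∘ₗ p, ?_, ?_⟩
  · ext w
    have : p (K w) = ⟨K w, w, rfl⟩ := hp' ⟨K w, w, rfl⟩
    simp [hf', this]
  · ext w
    simp [hf', hp']

/-- A vector in the kernel of one member of a smooth family of linear maps of constant rank extends
to a smooth family of vectors in the kernels. -/
lemma SmoothNear.exists_section_ker {K : E → W →L[ℝ] W'} {x : E} (hK : SmoothNear K x)
    (hrank : ∀ᶠ y in 𝓝 x, Module.finrank ℝ (LinearMap.ker (K y).toLinearMap) =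
      Module.finrank ℝ (LinearMap.ker (K x).toLinearMap))
    {w₀ : W} (hw₀ : K x w₀ = 0) :
    ∃ w : E → W, SmoothNear w x ∧ w x = w₀ ∧ ∀ᶠ y in 𝓝 x, K y (w y) = 0 := by
  obtain ⟨B, hB1, hB2⟩ := exists_generalized_inverse (K x).toLinearMap
  have hB1' : ∀ v, K x (B (K x v)) = K x v := fun v => LinearMap.congr_fun hB1 v
  have hB2' : ∀ v, B (K x (B v)) = B v := fun v => LinearMap.congr_fun hB2 v
  let B' : W' →L[ℝ] W := LinearMap.toContinuousLinearMap B
  have hB' : ∀ v, B' v = B v := fun _ => rfl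
  -- `M y = 1 + B (K y - K x)` is the identity at `x`, and on the kernel of `B ∘ K y` it agrees with
  -- the projection `1 - B ∘ K x` onto `ker (K x)`. The section is the preimage of `w₀` under `M y`.
  let M : E → W →L[ℝ] W := fun y => 1 + B'.comp (K y) - B'.comp (K x)
  have hM : SmoothNear M x := by
    refine SmoothNear.sub ?_ (smoothNear_const _ _)
    exact (smoothNear_const _ _).add ((smoothNear_const _ _).clm_comp hK)
  have hMx : M x = 1 := by simp [M]
  have hu : IsUnit (M x) := by simp [hMx]
  refine ⟨fun y => Ring.inverse (M y) w₀, (hM.ringInverse hu).clm_apply (smoothNear_const _ _),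
    by simp [hMx], ?_⟩
  have hunit : ∀ᶠ y in 𝓝 x, IsUnit (M y) :=
    hM.continuousAt.eventually (Units.isOpen.mem_nhds hu)
  filter_upwards [hunit, hrank] with y hy hr
  set w := Ring.inverse (M y) w₀
  have hinv : ∀ v, Ring.inverse (M y) (M y v) = v := fun v => by
    have := Ring.inverse_mul_cancel _ hy
    exact congrArg (fun f : W →L[ℝ] W => f v) this
  have hMw : M y w = w₀ := by
    have := Ring.mul_inverse_cancel _ hy
    exact congrArg (fun f : W →L[ℝ] W => f w₀) this
  have hMv : ∀ v, M y v = v + B (K y v) - B (K x v) := fun v => by simp [M, hB']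
  have hBK : B (K y w) = 0 := by
    have h := congrArg (fun v => B (K x v)) hMw
    simp only [hMv, map_add, map_sub, hB2', hw₀, map_zero] at h
    simpa using h
  have hle : LinearMap.ker (K y).toLinearMap ≤ LinearMap.ker (B ∘ₗ (K y).toLinearMap) := by
    intro v hv
    have : K y v = 0 := hv
    simp [this]
  -- `M y` embeds `ker (B ∘ K y)` into `ker (K x)`. As `ker (K y)` is contained in the former and
  -- has the dimension of the latter, the constant rank forces `ker (B ∘ K y) = ker (K y)`.
  have hinj : Module.finrank ℝ (LinearMap.ker (B ∘ₗ (K y).toLinearMap)) ≤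
      Module.finrank ℝ (LinearMap.ker (K x).toLinearMap) := by
    let κ : LinearMap.ker (B ∘ₗ (K y).toLinearMap) →ₗ[ℝ] LinearMap.ker (K x).toLinearMap :=
      ((LinearMap.id - B ∘ₗ (K x).toLinearMap).comp (Submodule.subtype _)).codRestrict _
        (fun v => by simp [hB1'])
    refine LinearMap.finrank_le_finrank_of_injective (f := κ) ?_
    intro v v' hvv
    have h1 : (v : W) - B (K x v) = v' - B (K x v') := congrArg Subtype.val hvv
    have h2 : ∀ a : LinearMap.ker (B ∘ₗ (K y).toLinearMap), M y a = a - B (K x a) := fun a => by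
      have : B (K y a) = 0 := a.2
      rw [hMv, this, add_zero]
    have : M y v = M y v' := by rw [h2, h2, h1]
    have := congrArg (fun v => Ring.inverse (M y) v) this
    simp only [hinv] at this
    exact Subtype.ext this
  have heq := Submodule.eq_of_le_of_finrank_le hle (by rw [hr]; exact hinj)
  have : w ∈ LinearMap.ker (B ∘ₗ (K y).toLinearMap) := by simpa using hBK
  rw [← heq] at this
  exact this

end Kernel

/-! ## Adapting frames -/

/-- Real `4 × 4` matrices. -/
abbrev M4 : Type := Matrix (Fin 4) (Fin 4) ℝ

/-- The signs of the standard neutral inner product. -/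
def η : Fin 4 → ℝ := ![-1, -1, 1, 1]

@[simp] lemma η_zero : η 0 = -1 := rfl
@[simp] lemma η_one : η 1 = -1 := rfl
@[simp] lemma η_two : η 2 = 1 := rfl
@[simp] lemma η_three : η 3 = 1 := rfl

@[simp] lemma η_mul_self (i : Fin 4) : η i * η i = 1 := by
  fin_cases i <;> simp

/-- The Gram matrix of the standard neutral inner product. -/
def H : M4 := Matrix.diagonal η

@[simp] lemma H_mul_H : H * H = 1 := by
  simp [H, Matrix.diagonal_mul_diagonal]

@[simp] lemma H_transpose : H.transpose = H := Matrix.diagonal_transpose _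

/-- The adjoint with respect to the standard neutral inner product. -/
def adj (X : M4) : M4 := H * X.transpose * H

lemma adj_one : adj 1 = 1 := by simp [adj]

lemma H_mul_H_mul (X : M4) : H * (H * X) = X := by
  rw [← mul_assoc, H_mul_H, one_mul]

lemma adj_mul (X Y : M4) : adj (X * Y) = adj Y * adj X := by
  simp [adj, Matrix.transpose_mul, mul_assoc, H_mul_H_mul]

lemma adj_adj (X : M4) : adj (adj X) = X := by
  simp [adj, Matrix.transpose_mul, mul_assoc, H_mul_H_mul]

lemma adj_continuous : Continuous adj := by
  unfold adj
  fun_prop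

variable {E : Type*} [NormedAddCommGroup E] [NormedSpace ℝ E]

lemma SmoothNear.transpose {X : E → M4} {x : E} (hX : SmoothNear X x) :
    SmoothNear (fun y => (X y).transpose) x :=
  smoothNear_matrix.2 fun i j => smoothNear_matrix.1 hX j i

lemma SmoothNear.adj {X : E → M4} {x : E} (hX : SmoothNear X x) :
    SmoothNear (fun y => adj (X y)) x :=
  ((smoothNear_const _ _).mul hX.transpose).mul (smoothNear_const _ _)

lemma eventually_isUnit {X : E → M4} {x : E} (hX : SmoothNear X x) (h1 : X x = 1) :
    ∀ᶠ y in 𝓝 x, IsUnit (X y) :=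
  hX.continuousAt.eventually (Units.isOpen.mem_nhds (by simp [h1]))

/-- `X^{-1/2}` for self-adjoint `X` near `1`. -/
lemma exists_inverse_sqrt {X : E → M4} {x : E} (hX : SmoothNear X x) (h1 : X x = 1)
    (hs : ∀ᶠ y in 𝓝 x, adj (X y) = X y) :
    ∃ q : E → M4, SmoothNear q x ∧ q x = 1 ∧ (∀ᶠ y in 𝓝 x, adj (q y) = q y) ∧
      (∀ᶠ y in 𝓝 x, q y * X y * q y = 1) ∧
      ∀ B : M4, (∀ᶠ y in 𝓝 x, Commute B (X y)) → ∀ᶠ y in 𝓝 x, Commute B (q y) := by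
  obtain ⟨q, h2, h3, h4, h5, h6⟩ := hX.exists_sqrt_comm h1 adj adj_continuous adj_one adj_mul hs
  have hu := eventually_isUnit h2 h3
  have hcomm : ∀ {a B : M4}, IsUnit a → Commute B a → Commute B (Ring.inverse a) := by
    rintro _ B ⟨a, rfl⟩ h
    simpa using h.units_inv_right
  refine ⟨fun y => Ring.inverse (q y), h2.ringInverse (by simp [h3]), by simp [h3], ?_, ?_, ?_⟩
  · filter_upwards [hu, h5] with y hy h7
    have e1 : adj (Ring.inverse (q y)) * q y = 1 := by
      have := adj_mul (q y) (Ring.inverse (q y))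
      rw [Ring.mul_inverse_cancel _ hy, adj_one, h7] at this
      exact this.symm
    calc adj (Ring.inverse (q y)) = adj (Ring.inverse (q y)) * (q y * Ring.inverse (q y)) := by
          rw [Ring.mul_inverse_cancel _ hy, mul_one]
      _ = _ := by rw [← mul_assoc, e1, one_mul]
  · filter_upwards [hu, h4] with y hy h7
    rw [← h7, ← mul_assoc, Ring.inverse_mul_cancel _ hy, one_mul, Ring.mul_inverse_cancel _ hy]
  · intro B hB
    filter_upwards [hu, h6 B hB] with y hy h7 using hcomm hy h7

/-- Smooth pseudo-orthonormalization. -/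
lemma exists_orthonormalizing {Y : E → M4} {x : E} (hY : SmoothNear Y x) (h1 : Y x = H)
    (hs : ∀ᶠ y in 𝓝 x, (Y y).transpose = Y y) :
    ∃ P : E → M4, SmoothNear P x ∧ P x = 1 ∧
      ∀ᶠ y in 𝓝 x, (P y).transpose * Y y * P y = H := by
  -- Symmetry of `Y` says that `H * Y` is self-adjoint for the standard form; `P` is its inverse
  -- square root.
  obtain ⟨q, h2, h3, h4, h5, -⟩ := exists_inverse_sqrt (X := fun y => H * Y y)
    ((smoothNear_const _ _).mul hY) (by simp [h1]) (by
      filter_upwards [hs] with y hy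
      simp [adj, Matrix.transpose_mul, hy, mul_assoc, H_mul_H])
  refine ⟨q, h2, h3, ?_⟩
  filter_upwards [h4, h5] with y h6 h7
  have h8 : (q y).transpose = H * q y * H := by
    conv_rhs => rw [← h6]
    simp [adj, mul_assoc, H_mul_H_mul]
  calc (q y).transpose * Y y * q y = H * (q y * (H * Y y) * q y) := by
        rw [h8]; simp only [mul_assoc]
    _ = H := by rw [h7, mul_one]

/-! ### Smooth intertwiners of similar families -/

section Intertwine

variable {A : Type*} [NormedRing A] [NormedAlgebra ℝ A]

/-- Multiplication on the left by `J` minus multiplication on the right by `J'`. -/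
def intertwine (J' J : A) : A →L[ℝ] A :=
  ContinuousLinearMap.mul ℝ A J - (ContinuousLinearMap.mul ℝ A).flip J'

lemma intertwine_apply (J' J L : A) : intertwine J' J L = J * L - L * J' := rfl

/-- Left multiplication by `Q` carries the commutant of `J'` bijectively onto the intertwiners from
`J'` to `J`. -/
lemma finrank_ker_intertwine {J' J Q : A} (hQ : IsUnit Q) (h : J * Q = Q * J') :
    Module.finrank ℝ (LinearMap.ker (intertwine J' J).toLinearMap) =
      Module.finrank ℝ (LinearMap.ker (intertwine J' J').toLinearMap) := by
  obtain ⟨Q, rfl⟩ := hQ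
  have h' : (↑Q⁻¹ : A) * J = J' * ↑Q⁻¹ := by
    rw [Units.inv_mul_eq_iff_eq_mul, ← mul_assoc, ← h, mul_assoc, Units.mul_inv, mul_one]
  symm
  refine LinearEquiv.finrank_eq (LinearEquiv.ofLinearMap
    (((LinearMap.mulLeft ℝ (Q : A)).comp (Submodule.subtype _)).codRestrict _ ?_)
    (((LinearMap.mulLeft ℝ (↑Q⁻¹ : A)).comp (Submodule.subtype _)).codRestrict _ ?_) ?_ ?_)
  · rintro ⟨L, hL⟩
    have hL : J' * L - L * J' = 0 := hL
    change J * (Q * L) - Q * L * J' = 0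
    rw [← mul_assoc, h, mul_assoc, mul_assoc, ← mul_sub, hL, mul_zero]
  · rintro ⟨L, hL⟩
    have hL : J * L - L * J' = 0 := hL
    change J' * (↑Q⁻¹ * L) - ↑Q⁻¹ * L * J' = 0
    rw [← mul_assoc, ← h', mul_assoc, mul_assoc, ← mul_sub, hL, mul_zero]
  · ext1 L
    exact Subtype.ext (by simp)
  · ext1 L
    exact Subtype.ext (by simp)

/-- A smooth family of constant similarity type admits a smooth intertwiner. -/
lemma SmoothNear.exists_intertwiner [FiniteDimensional ℝ A] {J : E → A} {x : E}
    (hJ : SmoothNear J x)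
    (hsim : ∀ᶠ y in 𝓝 x, ∃ Q : A, IsUnit Q ∧ J y * Q = Q * J x) :
    ∃ L : E → A, SmoothNear L x ∧ L x = 1 ∧ ∀ᶠ y in 𝓝 x, J y * L y = L y * J x := by
  have hK : SmoothNear (fun y => intertwine (J x) (J y)) x :=
    (hJ.clm (ContinuousLinearMap.mul ℝ A)).sub (smoothNear_const _ _)
  obtain ⟨L', hL'1, hL'2, hL'3⟩ := hK.exists_section_ker (w₀ := (1 : A))
    (hsim.mono fun y ⟨Q, hQ, h⟩ => finrank_ker_intertwine hQ h) (by simp [intertwine_apply])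
  simp only [intertwine_apply, sub_eq_zero] at hL'3
  exact ⟨L', hL'1, hL'2, hL'3⟩

end Intertwine

/-- The projection onto the first coordinate axis. -/
def proj₀ : M4 := Matrix.single 0 0 1

lemma proj₀_mul_self : proj₀ * proj₀ = proj₀ := by simp [proj₀]

lemma adj_proj₀ : adj proj₀ = proj₀ := by
  ext i j
  simp only [adj, H, Matrix.mul_diagonal, Matrix.diagonal_mul, Matrix.transpose_apply, proj₀]
  by_cases hi : i = 0
  · by_cases hj : j = 0
    · simp [hi, hj]
    · simp [hi, Matrix.single, Ne.symm hj]
  · simp [Matrix.single, Ne.symm hi]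

/-- A smooth family of self-adjoint matrices of constant similarity type, all commuting with the
projection onto the first axis, is smoothly conjugate to a constant one by pseudo-orthogonal
matrices commuting with that projection. -/
lemma exists_smooth_conjugation {J : E → M4} {x : E} (hJ : SmoothNear J x)
    (hs : ∀ᶠ y in 𝓝 x, adj (J y) = J y) (hp : ∀ᶠ y in 𝓝 x, Commute proj₀ (J y))
    (hsim : ∀ᶠ y in 𝓝 x, ∃ Q : M4, IsUnit Q ∧ J y * Q = Q * J x) :
    ∃ T : E → M4, SmoothNear T x ∧ T x = 1 ∧ (∀ᶠ y in 𝓝 x, (T y).transpose * H * T y = H) ∧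
      (∀ᶠ y in 𝓝 x, J y * T y = T y * J x) ∧ ∀ᶠ y in 𝓝 x, Commute proj₀ (T y) := by
  obtain ⟨L', hL'1, hL'2, hL'3⟩ := hJ.exists_intertwiner hsim
  let p : M4 := proj₀
  have hpp : p * p = p := proj₀_mul_self
  let p' : M4 := 1 - p
  have hpp' : p' * p' = p' := by simp [p', mul_sub, sub_mul, hpp]
  have hpp1 : p * p' = 0 := by simp [p', mul_sub, hpp]
  have hpp2 : p' * p = 0 := by simp [p', sub_mul, hpp]
  -- The block-diagonal part of `L'`. Since `J y` and `J x` are block diagonal, it still intertwines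
  -- them, and it commutes with the projection.
  let L : E → M4 := fun y => p * L' y * p + p' * L' y * p'
  have hL1 : SmoothNear L x :=
    (((smoothNear_const _ _).mul hL'1).mul (smoothNear_const _ _)).add
      (((smoothNear_const _ _).mul hL'1).mul (smoothNear_const _ _))
  have hL2 : L x = 1 := by simp [L, hL'2, hpp, hpp', p']
  have hJx : Commute p (J x) := hp.self_of_nhds
  have hp'J : ∀ {a : M4}, Commute p a → Commute p' a := fun h => (Commute.one_left _).sub_left h
  have hL3 : ∀ᶠ y in 𝓝 x, J y * L y = L y * J x := by
    filter_upwards [hp, hL'3] with y h1 h2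
    have h3 : Commute p' (J y) := hp'J h1
    have h4 : Commute p' (J x) := hp'J hJx
    have h1 : Commute p (J y) := h1
    simp only [L, mul_add, add_mul]
    congr 1
    · calc J y * (p * L' y * p) = p * (J y * L' y) * p := by
            rw [← mul_assoc, ← mul_assoc, ← h1.eq, mul_assoc p]
        _ = _ := by rw [h2, mul_assoc, mul_assoc, mul_assoc, ← hJx.eq]; simp only [mul_assoc]
    · calc J y * (p' * L' y * p') = p' * (J y * L' y) * p' := by
            rw [← mul_assoc, ← mul_assoc, ← h3.eq, mul_assoc p']
        _ = _ := by rw [h2, mul_assoc, mul_assoc, mul_assoc, ← h4.eq]; simp only [mul_assoc]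
  have hL4 : ∀ y, Commute p (L y) := by
    intro y
    change p * L y = L y * p
    simp only [L, mul_add, add_mul, mul_assoc, hpp, hpp2, mul_zero]
    simp only [← mul_assoc, hpp, hpp1, zero_mul]
  have hX1 : SmoothNear (fun y => adj (L y) * L y) x := hL1.adj.mul hL1
  obtain ⟨q, hq1, hq2, hq3, hq4, hq5⟩ := exists_inverse_sqrt hX1 (by simp [hL2, adj_one])
    (Eventually.of_forall fun y => by rw [adj_mul, adj_adj])
  have hsx : adj (J x) = J x := hs.self_of_nhds
  -- Taking adjoints of `J L = L J(x)` gives `L* J = J(x) L*`, so `L* L` commutes with `J(x)`, and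
  -- therefore so does its inverse square root.
  have hq6 := hq5 (J x) (by
    filter_upwards [hL3, hs] with y h1 h2
    have h3 := congrArg adj h1
    rw [adj_mul, adj_mul, h2, hsx] at h3
    change J x * (adj (L y) * L y) = adj (L y) * L y * J x
    rw [← mul_assoc, ← h3, mul_assoc, h1, mul_assoc])
  have hq7 := hq5 p (Eventually.of_forall fun y => by
    have h3 := congrArg adj (hL4 y).eq
    rw [adj_mul, adj_mul, show adj p = p from adj_proj₀] at h3
    change p * (adj (L y) * L y) = adj (L y) * L y * p
    rw [← mul_assoc, ← h3, mul_assoc, (hL4 y).eq, mul_assoc])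
  -- The polar factor `L (L* L)^(-1/2)`: pseudo-orthogonal, and still an intertwiner commuting with
  -- the projection.
  refine ⟨fun y => L y * q y, hL1.mul hq1, by simp [hL2, hq2], ?_, ?_, ?_⟩
  · filter_upwards [hq3, hq4] with y h1 h2
    have h3 : adj (L y * q y) * (L y * q y) = 1 := by
      rw [adj_mul, h1, ← h2]; simp only [mul_assoc]
    have h4 := congrArg (fun a => H * a) h3
    simp only [mul_one] at h4
    refine Eq.trans ?_ h4
    simp [adj, mul_assoc, H_mul_H_mul]
  · filter_upwards [hL3, hq6] with y h1 h2
    rw [← mul_assoc, h1, mul_assoc, h2.eq, mul_assoc]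
  · filter_upwards [hq7] with y h1 using (hL4 y).mul_right h1

/-! ## Components of algebraic curvature tensors -/

/-- Arrays of components of `(0,4)`-tensors on a four-dimensional space. -/
abbrev Comp : Type := Fin 4 → Fin 4 → Fin 4 → Fin 4 → ℝ

/-- The symmetries of a curvature tensor. -/
structure IsAlgCurv (R : Comp) : Prop where
  anti₁ : ∀ a b c d, R b a c d = -R a b c d
  anti₂ : ∀ c d a b, R a b d c = -R a b c d
  bianchi : ∀ a b c d, R a b c d + R b c a d + R c a b d = 0

namespace IsAlgCurv

variable {R : Comp} (h : IsAlgCurv R)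
include h

lemma diag₁ (a c d : Fin 4) : R a a c d = 0 := by
  linarith [h.anti₁ a a c d]

lemma diag₂ (c a b : Fin 4) : R a b c c = 0 := by
  linarith [h.anti₂ c c a b]

lemma pair (a b c d : Fin 4) : R c d a b = R a b c d := by
  linarith [h.bianchi a b c d, h.bianchi b c d a, h.bianchi c d a b, h.bianchi d a b c,
    h.anti₂ a d b c, h.anti₂ a b c d, h.anti₁ b d c a, h.anti₂ a c b d, h.anti₁ c a d b,
    h.anti₂ b d c a, h.anti₂ b c d a, h.anti₂ c d a b]

lemma sub {S : Comp} (hS : IsAlgCurv S) :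
    IsAlgCurv (fun a b c d => R a b c d - S a b c d) where
  anti₁ a b c d := by simp only [h.anti₁ a b, hS.anti₁ a b]; ring
  anti₂ c d a b := by simp only [h.anti₂ c d, hS.anti₂ c d]; ring
  bianchi a b c d := by linarith [h.bianchi a b c d, hS.bianchi a b c d]

end IsAlgCurv

lemma eq_zero_of_anti {f : Fin 4 → Fin 4 → ℝ} (h : ∀ a b, f b a = -f a b)
    (h01 : f 0 1 = 0) (h23 : f 2 3 = 0) (h02 : f 0 2 = 0) (h13 : f 1 3 = 0) (h03 : f 0 3 = 0)
    (h12 : f 1 2 = 0) (a b : Fin 4) : f a b = 0 := by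
  have hd : ∀ a, f a a = 0 := fun a => by linarith [h a a]
  fin_cases a <;> fin_cases b <;>
    simp [hd, h 0 1, h 0 2, h 0 3, h 1 2, h 1 3, h 2 3, h01, h02, h03, h12, h13, h23]

/-- A curvature tensor is determined by its 20 independent components. -/
lemma IsAlgCurv.eq_zero {R : Comp} (h : IsAlgCurv R)
    (h1 : R 0 1 0 1 = 0) (h2 : R 0 1 2 3 = 0) (h3 : R 0 1 0 2 = 0) (h4 : R 0 1 1 3 = 0)
    (h5 : R 0 1 0 3 = 0) (h6 : R 0 1 1 2 = 0) (h7 : R 2 3 2 3 = 0) (h8 : R 2 3 0 2 = 0)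
    (h9 : R 2 3 1 3 = 0) (h10 : R 2 3 0 3 = 0) (h11 : R 2 3 1 2 = 0) (h12 : R 0 2 0 2 = 0)
    (h13 : R 0 2 1 3 = 0) (h14 : R 0 2 0 3 = 0) (h15 : R 0 2 1 2 = 0) (h16 : R 1 3 1 3 = 0)
    (h17 : R 1 3 0 3 = 0) (h18 : R 1 3 1 2 = 0) (h19 : R 0 3 0 3 = 0) (h20 : R 0 3 1 2 = 0)
    (h21 : R 1 2 1 2 = 0) (a b c d : Fin 4) : R a b c d = 0 := by
  have p := h.pair
  have k : ∀ a b, R a b 0 1 = 0 → R a b 2 3 = 0 → R a b 0 2 = 0 → R a b 1 3 = 0 →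
      R a b 0 3 = 0 → R a b 1 2 = 0 → ∀ c d, R a b c d = 0 := fun a b k1 k2 k3 k4 k5 k6 =>
    eq_zero_of_anti (fun c d => h.anti₂ c d a b) k1 k2 k3 k4 k5 k6
  refine eq_zero_of_anti (f := fun a b => R a b c d) (fun a b => h.anti₁ a b c d) ?_ ?_ ?_ ?_ ?_ ?_
    a b
  · exact k _ _ h1 h2 h3 h4 h5 h6 c d
  · exact k _ _ ((p 0 1 2 3).trans h2) h7 h8 h9 h10 h11 c d
  · exact k _ _ ((p 0 1 0 2).trans h3) ((p 2 3 0 2).trans h8) h12 h13 h14 h15 c d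
  · exact k _ _ ((p 0 1 1 3).trans h4) ((p 2 3 1 3).trans h9) ((p 0 2 1 3).trans h13) h16 h17 h18
      c d
  · exact k _ _ ((p 0 1 0 3).trans h5) ((p 2 3 0 3).trans h10) ((p 0 2 0 3).trans h14)
      ((p 1 3 0 3).trans h17) h19 h20 c d
  · exact k _ _ ((p 0 1 1 2).trans h6) ((p 2 3 1 2).trans h11) ((p 0 2 1 2).trans h15)
      ((p 1 3 1 2).trans h18) ((p 0 3 1 2).trans h20) h21 c d

/-! ### Jacobi operators and half flat tensors -/

/-- The matrix of the Jacobi operator of `R` at the vector with coordinates `x`. -/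
def jac (R : Comp) (x : Fin 4 → ℝ) : M4 :=
  Matrix.of fun l k => η l * ∑ i, ∑ j, x i * x j * R k i j l

lemma jac_apply (R : Comp) (x : Fin 4 → ℝ) (l k : Fin 4) :
    jac R x l k = η l * ∑ i, ∑ j, x i * x j * R k i j l := rfl

/-- The standard neutral quadratic form. -/
def qf (x : Fin 4 → ℝ) : ℝ := -x 0 ^ 2 - x 1 ^ 2 + x 2 ^ 2 + x 3 ^ 2

lemma jac_smul (R : Comp) (r : ℝ) (x : Fin 4 → ℝ) : jac R (r • x) = r ^ 2 • jac R x := by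
  ext l k
  simp only [jac_apply, Pi.smul_apply, smul_eq_mul, Matrix.smul_apply, Finset.mul_sum]
  refine Finset.sum_congr rfl fun i _ => Finset.sum_congr rfl fun j _ => ?_
  ring

lemma jac_e0 (R : Comp) (l k : Fin 4) : jac R ![1, 0, 0, 0] l k = η l * R k 0 0 l := by
  simp [jac_apply, Fin.sum_univ_four]

/-- Half conformally flat Einstein curvature tensors, in an orthonormal frame: all components are
determined by the Jacobi operator at the first frame vector. The sign is the orientation. -/
structure IsHalfFlat (s : ℝ) (R : Comp) : Prop where
  r0123 : R 0 1 2 3 = s * (2 * R 0 1 0 1 + R 0 2 0 2 + R 0 3 0 3) / 3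
  r0312 : R 0 3 1 2 = s * (-R 0 1 0 1 + R 0 2 0 2 - 2 * R 0 3 0 3) / 3
  r0213 : R 0 2 1 3 = s * (R 0 1 0 1 + 2 * R 0 2 0 2 - R 0 3 0 3) / 3
  r2323 : R 2 3 2 3 = R 0 1 0 1
  r1313 : R 1 3 1 3 = R 0 2 0 2
  r1212 : R 1 2 1 2 = R 0 3 0 3
  r1312 : R 1 3 1 2 = -R 0 2 0 3
  r1303 : R 1 3 0 3 = s * R 0 2 0 3
  r0212 : R 0 2 1 2 = -(s * R 0 2 0 3)
  r2312 : R 2 3 1 2 = -R 0 1 0 3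
  r2303 : R 2 3 0 3 = s * R 0 1 0 3
  r0112 : R 0 1 1 2 = -(s * R 0 1 0 3)
  r2313 : R 2 3 1 3 = R 0 1 0 2
  r2302 : R 2 3 0 2 = s * R 0 1 0 2
  r0113 : R 0 1 1 3 = s * R 0 1 0 2

lemma isClosed_isHalfFlat (s : ℝ) : IsClosed {R : Comp | IsHalfFlat s R} := by
  have : {R : Comp | IsHalfFlat s R} = {R : Comp |
      R 0 1 2 3 = s * (2 * R 0 1 0 1 + R 0 2 0 2 + R 0 3 0 3) / 3 ∧
      R 0 3 1 2 = s * (-R 0 1 0 1 + R 0 2 0 2 - 2 * R 0 3 0 3) / 3 ∧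
      R 0 2 1 3 = s * (R 0 1 0 1 + 2 * R 0 2 0 2 - R 0 3 0 3) / 3 ∧
      R 2 3 2 3 = R 0 1 0 1 ∧ R 1 3 1 3 = R 0 2 0 2 ∧ R 1 2 1 2 = R 0 3 0 3 ∧
      R 1 3 1 2 = -R 0 2 0 3 ∧ R 1 3 0 3 = s * R 0 2 0 3 ∧ R 0 2 1 2 = -(s * R 0 2 0 3) ∧
      R 2 3 1 2 = -R 0 1 0 3 ∧ R 2 3 0 3 = s * R 0 1 0 3 ∧ R 0 1 1 2 = -(s * R 0 1 0 3) ∧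
      R 2 3 1 3 = R 0 1 0 2 ∧ R 2 3 0 2 = s * R 0 1 0 2 ∧ R 0 1 1 3 = s * R 0 1 0 2} := by
    ext R
    constructor
    · rintro ⟨h1, h2, h3, h4, h5, h6, h7, h8, h9, h10, h11, h12, h13, h14, h15⟩
      exact ⟨h1, h2, h3, h4, h5, h6, h7, h8, h9, h10, h11, h12, h13, h14, h15⟩
    · rintro ⟨h1, h2, h3, h4, h5, h6, h7, h8, h9, h10, h11, h12, h13, h14, h15⟩
      exact ⟨h1, h2, h3, h4, h5, h6, h7, h8, h9, h10, h11, h12, h13, h14, h15⟩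
  rw [this]
  simp only [Set.ofPred_and]
  repeat' refine IsClosed.inter ?_ ?_
  all_goals exact isClosed_eq (by fun_prop) (by fun_prop)

/-- Half flat tensors of the same orientation with the same Jacobi operator at the first frame
vector agree. -/
lemma IsHalfFlat.eq_of_jac_eq {s : ℝ} {R S : Comp} (hR : IsAlgCurv R) (hS : IsAlgCurv S)
    (hsR : IsHalfFlat s R) (hsS : IsHalfFlat s S)
    (h : jac R ![1, 0, 0, 0] = jac S ![1, 0, 0, 0]) : R = S := by
  have e : ∀ k l, R 0 k 0 l = S 0 k 0 l := fun k l => by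
    have := congrFun (congrFun h l) k
    rw [jac_e0, jac_e0] at this
    have h2 : η l * (η l * R k 0 0 l) = η l * (η l * S k 0 0 l) := by rw [this]
    rw [← mul_assoc, ← mul_assoc, η_mul_self, one_mul, one_mul, hR.anti₁ 0 k, hS.anti₁ 0 k] at h2
    linarith
  funext a b c d
  rw [← sub_eq_zero]
  refine (hR.sub hS).eq_zero ?_ ?_ ?_ ?_ ?_ ?_ ?_ ?_ ?_ ?_ ?_ ?_ ?_ ?_ ?_ ?_ ?_ ?_ ?_ ?_ ?_ a b c d <;>
    simp only [hsR.r0123, hsR.r0312, hsR.r0213, hsR.r2323, hsR.r1313, hsR.r1212, hsR.r1312,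
      hsR.r1303, hsR.r0212, hsR.r2312, hsR.r2303, hsR.r0112, hsR.r2313, hsR.r2302, hsR.r0113,
      hsS.r0123, hsS.r0312, hsS.r0213, hsS.r2323, hsS.r1313, hsS.r1212, hsS.r1312,
      hsS.r1303, hsS.r0212, hsS.r2312, hsS.r2303, hsS.r0112, hsS.r2313, hsS.r2302, hsS.r0113,
      e, sub_self]

/-- The Einstein condition in an orthonormal frame. -/
structure IsEinsteinComp (R : Comp) : Prop where
  r1212 : R 1 2 1 2 = R 0 3 0 3
  r1312 : R 1 3 1 2 = -R 0 2 0 3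
  r1303 : R 1 3 0 3 = -R 0 2 1 2
  r1313 : R 1 3 1 3 = R 0 2 0 2
  r2312 : R 2 3 1 2 = -R 0 1 0 3
  r2303 : R 2 3 0 3 = -R 0 1 1 2
  r2313 : R 2 3 1 3 = R 0 1 0 2
  r2302 : R 2 3 0 2 = R 0 1 1 3
  r2323 : R 2 3 2 3 = R 0 1 0 1

/-- The expanded form of minus the Ricci quadratic form; the brackets are combinations of the
components that the Einstein condition compares. -/
lemma trace_jac {R : Comp} (h : IsAlgCurv R) (x : Fin 4 → ℝ) :
    (jac R x).trace =
      x 0 ^ 2 * (R 0 1 0 1 - R 0 2 0 2 - R 0 3 0 3)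
      + x 1 ^ 2 * (R 0 1 0 1 - R 1 2 1 2 - R 1 3 1 3)
      + x 2 ^ 2 * (R 0 2 0 2 + R 1 2 1 2 - R 2 3 2 3)
      + x 3 ^ 2 * (R 0 3 0 3 + R 1 3 1 3 - R 2 3 2 3)
      - 2 * (x 0 * x 1) * (R 0 2 1 2 + R 1 3 0 3) - 2 * (x 0 * x 2) * (R 0 1 1 2 + R 2 3 0 3)
      - 2 * (x 0 * x 3) * (R 0 1 1 3 - R 2 3 0 2) + 2 * (x 1 * x 2) * (R 0 1 0 2 - R 2 3 1 3)
      + 2 * (x 1 * x 3) * (R 0 1 0 3 + R 2 3 1 2) + 2 * (x 2 * x 3) * (R 0 2 0 3 + R 1 3 1 2) := by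
  simp only [Matrix.trace, Matrix.diag, jac_apply, Fin.sum_univ_four, η_zero, η_one, η_two,
    η_three, h.diag₁, h.diag₂, h.anti₁ 0 1, h.anti₁ 0 2, h.anti₁ 0 3, h.anti₁ 1 2, h.anti₁ 1 3,
    h.anti₁ 2 3, h.anti₂ 0 1, h.anti₂ 0 2, h.anti₂ 0 3, h.anti₂ 1 2, h.anti₂ 1 3,
    h.anti₂ 2 3, h.pair 0 1 0 2, h.pair 0 1 0 3, h.pair 0 1 1 2, h.pair 0 1 1 3,
    h.pair 2 3 0 2, h.pair 2 3 0 3, h.pair 2 3 1 2, h.pair 2 3 1 3, h.pair 0 2 0 3,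
    h.pair 0 2 1 2, h.pair 1 3 0 3, h.pair 1 3 1 2]
  ring

/-- The timelike cone is open, so an identity of quadratic forms on it is an identity of
coefficients: the Ricci form is a multiple of the metric. -/
lemma isEinsteinComp_of_trace {R : Comp} (h : IsAlgCurv R) {c : ℝ}
    (hc : ∀ x, qf x < 0 → (jac R x).trace = c * qf x) : IsEinsteinComp R := by
  have key : ∀ x₀ x₁ x₂ x₃ : ℝ, -x₀ ^ 2 - x₁ ^ 2 + x₂ ^ 2 + x₃ ^ 2 < 0 →
      x₀ ^ 2 * (R 0 1 0 1 - R 0 2 0 2 - R 0 3 0 3)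
      + x₁ ^ 2 * (R 0 1 0 1 - R 1 2 1 2 - R 1 3 1 3)
      + x₂ ^ 2 * (R 0 2 0 2 + R 1 2 1 2 - R 2 3 2 3)
      + x₃ ^ 2 * (R 0 3 0 3 + R 1 3 1 3 - R 2 3 2 3)
      - 2 * (x₀ * x₁) * (R 0 2 1 2 + R 1 3 0 3) - 2 * (x₀ * x₂) * (R 0 1 1 2 + R 2 3 0 3)
      - 2 * (x₀ * x₃) * (R 0 1 1 3 - R 2 3 0 2) + 2 * (x₁ * x₂) * (R 0 1 0 2 - R 2 3 1 3)
      + 2 * (x₁ * x₃) * (R 0 1 0 3 + R 2 3 1 2) + 2 * (x₂ * x₃) * (R 0 2 0 3 + R 1 3 1 2) =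
      c * (-x₀ ^ 2 - x₁ ^ 2 + x₂ ^ 2 + x₃ ^ 2) := fun x₀ x₁ x₂ x₃ hx => by
    have := hc ![x₀, x₁, x₂, x₃] (by simpa [qf] using hx)
    rw [trace_jac h] at this
    simpa [qf] using this
  -- A quadratic form in four variables has ten coefficients, and these ten vectors determine them;
  -- the entries 2 keep the vectors timelike.
  have k0 := key 1 0 0 0 (by norm_num)
  have k1 := key 0 1 0 0 (by norm_num)
  have k01 := key 1 1 0 0 (by norm_num)
  have k02 := key 2 0 1 0 (by norm_num)
  have k02' := key 2 0 (-1) 0 (by norm_num)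
  have k03 := key 2 0 0 1 (by norm_num)
  have k03' := key 2 0 0 (-1) (by norm_num)
  have k12 := key 0 2 1 0 (by norm_num)
  have k13 := key 0 2 0 1 (by norm_num)
  have k23 := key 2 0 1 1 (by norm_num)
  constructor <;> linarith

/-- The restriction of `R` to (anti-)self-dual bivectors, up to a factor `2`, for Einstein `R`. -/
def dualForm (s : ℝ) (R : Comp) (a b c : ℝ) : ℝ :=
  (R 0 1 0 1 + s * R 0 1 2 3) * a ^ 2 + (R 0 2 0 2 + s * R 0 2 1 3) * b ^ 2
    + (R 0 3 0 3 - s * R 0 3 1 2) * c ^ 2 + 2 * (R 0 1 0 2 + s * R 0 1 1 3) * (a * b)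
    + 2 * (R 0 1 0 3 - s * R 0 1 1 2) * (a * c) + 2 * (R 0 2 0 3 - s * R 0 2 1 2) * (b * c)

lemma bianchi_comp {R : Comp} (h : IsAlgCurv R) : R 0 2 1 3 = R 0 1 2 3 + R 0 3 1 2 := by
  linarith [h.bianchi 0 1 2 3, h.anti₁ 0 2 1 3, h.pair 0 3 1 2]

/-- For a decomposable null vector the squared norm of the Jacobi operator splits. -/
lemma trace_jac_sq_null {R : Comp} (h : IsAlgCurv R) (hE : IsEinsteinComp R) (s t p q : ℝ) :
    (jac R ![s * p + t * q, t * p - s * q, s * p - t * q, s * q + t * p] *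
      jac R ![s * p + t * q, t * p - s * q, s * p - t * q, s * q + t * p]).trace =
      2 * dualForm (-1) R (-(s ^ 2 + t ^ 2)) (-2 * (s * t)) (s ^ 2 - t ^ 2) *
        dualForm 1 R (p ^ 2 + q ^ 2) (-2 * (p * q)) (p ^ 2 - q ^ 2) := by
  -- In the coordinates x₀+x₂, x₃-x₁, x₁+x₃, x₀-x₂ the vector is twice the rank-one matrix with
  -- entries sp, sq, tp, tq. The factorization is a polynomial identity modulo the curvature
  -- symmetries and the Einstein relations.
  simp only [Matrix.trace, Matrix.diag, Matrix.mul_apply, jac_apply, Fin.sum_univ_four, η_zero,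
    η_one, η_two, Matrix.cons_val,
    η_three, h.diag₁, h.diag₂, h.anti₁ 0 1, h.anti₁ 0 2, h.anti₁ 0 3, h.anti₁ 1 2, h.anti₁ 1 3,
    h.anti₁ 2 3, h.anti₂ 0 1, h.anti₂ 0 2, h.anti₂ 0 3, h.anti₂ 1 2, h.anti₂ 1 3,
    h.anti₂ 2 3, h.pair 0 1 2 3, h.pair 0 1 0 2, h.pair 0 1 0 3, h.pair 0 1 1 2, h.pair 0 1 1 3,
    h.pair 2 3 0 2, h.pair 2 3 0 3, h.pair 2 3 1 2, h.pair 2 3 1 3, h.pair 0 2 1 3, h.pair 0 2 0 3,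
    h.pair 0 2 1 2, h.pair 1 3 0 3, h.pair 1 3 1 2, h.pair 0 3 1 2, hE.r1212, hE.r1312, hE.r1303,
    hE.r1313, hE.r2312, hE.r2303, hE.r2313, hE.r2302, hE.r2323, bianchi_comp h, dualForm]
  ring

/-- The arguments parametrize the cone a² = b² + c². A quadratic form vanishing on it is a multiple
of a² - b² - c², so this half of the tensor is pure trace and the other half, of orientation `-s`,
carries the rest. The Bianchi identity then fixes the mixed components. -/
lemma isHalfFlat_of_dualForm {R : Comp} (h : IsAlgCurv R) (hE : IsEinsteinComp R) {s : ℝ}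
    (hs : s = 1 ∨ s = -1)
    (hd : ∀ p q : ℝ, dualForm s R (-(p ^ 2 + q ^ 2)) (-2 * (p * q)) (p ^ 2 - q ^ 2) = 0) :
    IsHalfFlat (-s) R := by
  -- On the cone the form is a binary quartic, whose five coefficients are determined by these five
  -- values.
  have h1 := hd 1 0
  have h2 := hd 0 1
  have h3 := hd 1 1
  have h4 := hd 1 (-1)
  have h5 := hd 2 1
  have hb := bianchi_comp h
  obtain ⟨e1, e2, e3, e4, e5, e6, e7, e8, e9⟩ := hE
  simp only [dualForm] at h1 h2 h3 h4 h5
  rcases hs with rfl | rfl <;> constructor <;> linarith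

/-- Every null vector is a limit of timelike vectors, along which the right-hand side tends to 0. -/
lemma eq_zero_of_null {f : (Fin 4 → ℝ) → ℝ} (hf : Continuous f) {c : ℝ}
    (h : ∀ x, qf x < 0 → f x = c * qf x ^ 2) {x : Fin 4 → ℝ} (hx : qf x = 0) : f x = 0 := by
  -- The sign `r` makes |x₀| grow along the path x₀ + εr, so that the path is timelike for every ε >
  -- 0.
  obtain ⟨r, hr, hrx⟩ : ∃ r : ℝ, r ^ 2 = 1 ∧ 0 ≤ r * x 0 := by
    rcases le_total 0 (x 0) with h0 | h0
    · exact ⟨1, by norm_num, by simpa using h0⟩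
    · exact ⟨-1, by norm_num, by linarith⟩
  let γ : ℝ → Fin 4 → ℝ := fun ε => ![x 0 + ε * r, x 1, x 2, x 3]
  have hγ : Continuous γ := by
    refine continuous_pi fun i => ?_
    fin_cases i <;> simp [γ] <;> fun_prop
  have hq : Continuous qf := by unfold qf; fun_prop
  have hcl : IsClosed {ε : ℝ | f (γ ε) = c * qf (γ ε) ^ 2} :=
    isClosed_eq (hf.comp hγ) (by have := hq.comp hγ; fun_prop)
  have hsub : Set.Ioi (0 : ℝ) ⊆ {ε : ℝ | f (γ ε) = c * qf (γ ε) ^ 2} := by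
    intro ε hε
    refine h _ ?_
    have hε : 0 < ε := hε
    have : qf (γ ε) = qf x - 2 * (ε * (r * x 0)) - ε ^ 2 * r ^ 2 := by simp [qf, γ]; ring
    rw [this, hx, hr]
    have := mul_nonneg hε.le hrx
    nlinarith [pow_pos hε 2]
  have h0 : (0 : ℝ) ∈ {ε : ℝ | f (γ ε) = c * qf (γ ε) ^ 2} := by
    refine closure_minimal hsub hcl ?_
    rw [closure_Ioi]
    exact Set.self_mem_Ici
  have hγ0 : γ 0 = x := by
    ext i; fin_cases i <;> simp [γ]
  have h0 : f (γ 0) = c * qf (γ 0) ^ 2 := h0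
  rw [hγ0, hx] at h0
  simpa using h0

lemma exists_unit_smul {x : Fin 4 → ℝ} (hx : qf x < 0) :
    ∃ (r : ℝ) (y : Fin 4 → ℝ), x = r • y ∧ qf y = -1 ∧ r ^ 2 = -qf x := by
  have hr : 0 < Real.sqrt (-qf x) := Real.sqrt_pos.2 (by linarith)
  have hr2 : Real.sqrt (-qf x) ^ 2 = -qf x := Real.sq_sqrt (by linarith)
  have hs : ∀ (r : ℝ) (y : Fin 4 → ℝ), qf (r • y) = r ^ 2 * qf y := fun r y => by
    simp [qf]; ring
  refine ⟨_, (Real.sqrt (-qf x))⁻¹ • x, (smul_inv_smul₀ hr.ne' x).symm, ?_, hr2⟩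
  rw [hs, inv_pow, hr2, inv_neg, neg_mul, inv_mul_cancel₀ hx.ne]

/-- A curvature tensor for which the traces of the Jacobi operator and of its square do not depend
on the unit timelike vector is half conformally flat and Einstein. -/
lemma exists_isHalfFlat {R : Comp} (h : IsAlgCurv R) {c₁ c₂ : ℝ}
    (h₁ : ∀ x, qf x = -1 → (jac R x).trace = c₁)
    (h₂ : ∀ x, qf x = -1 → (jac R x * jac R x).trace = c₂) :
    ∃ s : ℝ, (s = 1 ∨ s = -1) ∧ IsHalfFlat s R := by
  have hE : IsEinsteinComp R := isEinsteinComp_of_trace h (c := -c₁) fun x hx => by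
    obtain ⟨r, y, rfl, hy, hr⟩ := exists_unit_smul hx
    rw [jac_smul, Matrix.trace_smul, h₁ y hy, hr, smul_eq_mul]
    ring
  have hcont : Continuous fun x => (jac R x * jac R x).trace := by
    simp only [Matrix.trace, Matrix.diag, Matrix.mul_apply, jac_apply]
    fun_prop
  have hnull : ∀ x, qf x = 0 → (jac R x * jac R x).trace = 0 := fun x hx =>
    eq_zero_of_null hcont (c := c₂) (fun x hx => by
      obtain ⟨r, y, rfl, hy, hr⟩ := exists_unit_smul hx
      have : qf (r • y) = -r ^ 2 := by linarith
      rw [jac_smul, smul_mul_smul_comm, Matrix.trace_smul, h₂ y hy, smul_eq_mul, this]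
      ring) hx
  have hprod : ∀ s t p q : ℝ, dualForm (-1) R (-(s ^ 2 + t ^ 2)) (-2 * (s * t)) (s ^ 2 - t ^ 2) *
        dualForm 1 R (p ^ 2 + q ^ 2) (-2 * (p * q)) (p ^ 2 - q ^ 2) = 0 := fun s t p q => by
    have := hnull ![s * p + t * q, t * p - s * q, s * p - t * q, s * q + t * p]
      (by simp [qf]; ring)
    rw [trace_jac_sq_null h hE, mul_assoc] at this
    linarith
  by_cases hd : ∀ s t : ℝ, dualForm (-1) R (-(s ^ 2 + t ^ 2)) (-2 * (s * t)) (s ^ 2 - t ^ 2) = 0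
  · exact ⟨-(-1), by norm_num, isHalfFlat_of_dualForm h hE (Or.inr rfl) hd⟩
  · push Not at hd
    obtain ⟨s, t, hst⟩ := hd
    refine ⟨-1, Or.inr rfl, isHalfFlat_of_dualForm h hE (Or.inl rfl) fun p q => ?_⟩
    -- Replacing (p,q) by (q,-p) changes the argument of the form only by an overall sign, which a
    -- quadratic form does not see.
    have := (mul_eq_zero.1 (hprod s t q (-p))).resolve_left hst
    rw [← this]
    simp only [dualForm]
    ring

/-! ## Similarity over the complex numbers -/

/-- Real matrices that are similar over `ℂ` are similar over `ℝ`. -/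
lemma exists_real_similarity {n : Type*} [Fintype n] [DecidableEq n] {J J' : Matrix n n ℝ}
    {P : Matrix n n ℂ} (hP : IsUnit P)
    (h : J.map Complex.ofRealHom * P = P * J'.map Complex.ofRealHom) :
    ∃ Q : Matrix n n ℝ, IsUnit Q ∧ J * Q = Q * J' := by
  let X : Matrix n n ℝ := P.map Complex.re
  let Y : Matrix n n ℝ := P.map Complex.im
  have hX : J * X = X * J' := by
    ext i j
    have := congrArg Complex.re (congrFun (congrFun h i) j)
    simpa [Matrix.mul_apply, X] using this
  have hY : J * Y = Y * J' := by
    ext i j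
    have := congrArg Complex.im (congrFun (congrFun h i) j)
    simpa [Matrix.mul_apply, Y] using this
  -- The real and imaginary parts of `P` both intertwine, hence so does X + tY for every real t. Its
  -- determinant is a polynomial in t, nonzero because t = i gives det P, so some real t yields an
  -- invertible matrix.
  let D : Matrix n n (Polynomial ℝ) := X.map Polynomial.C + Y.map (fun a => Polynomial.X * Polynomial.C a)
  have hD : D.det ≠ 0 := by
    intro h0
    have h1 := congrArg (Polynomial.eval₂RingHom Complex.ofRealHom Complex.I) h0
    rw [RingHom.map_det, map_zero] at h1
    have h2 : (Polynomial.eval₂RingHom Complex.ofRealHom Complex.I).mapMatrix D = P := by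
      ext i j
      apply Complex.ext <;> simp [D, X, Y]
    rw [h2] at h1
    exact ((Matrix.isUnit_iff_isUnit_det P).1 hP).ne_zero h1
  obtain ⟨t, ht⟩ : ∃ t : ℝ, D.det.eval t ≠ 0 := by
    by_contra! hc
    exact hD (Polynomial.funext fun t => by simp [hc t])
  have h3 : (Polynomial.evalRingHom t).mapMatrix D = X + t • Y := by
    ext i j
    simp [D, mul_comm t]
  refine ⟨X + t • Y, ?_, ?_⟩
  · rw [Matrix.isUnit_iff_isUnit_det, ← h3, ← RingHom.map_det]
    exact ht.isUnit
  · rw [mul_add, add_mul, hX, Matrix.mul_smul, Matrix.smul_mul, hY]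

lemma exists_similarity_to_jordan {V : Type*} [AddCommGroup V] [Module ℝ V] {T : V →ₗ[ℝ] V}
    {N : Matrix (Fin 4) (Fin 4) ℂ} (hT : HasJordanNormalForm T N)
    (b : Module.Basis (Fin 4) ℝ V) :
    ∃ P : Matrix (Fin 4) (Fin 4) ℂ, IsUnit P ∧
      (LinearMap.toMatrix b b T).map Complex.ofRealHom * P = P * N := by
  obtain ⟨-, b', hb'⟩ := hT
  refine ⟨(Algebra.TensorProduct.basis ℂ b).toMatrix b', ?_, ?_⟩
  · exact ⟨⟨_, b'.toMatrix (Algebra.TensorProduct.basis ℂ b), Module.Basis.toMatrix_mul_toMatrix_flip _ _,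
      Module.Basis.toMatrix_mul_toMatrix_flip _ _⟩, rfl⟩
  · have h1 := LinearMap.toMatrix_baseChange (A := ℂ) T b b
    have h2 : (LinearMap.toMatrix b b T).map Complex.ofRealHom =
        LinearMap.toMatrix (Algebra.TensorProduct.basis ℂ b) (Algebra.TensorProduct.basis ℂ b) (T.baseChange ℂ) := by
      exact h1.symm
    rw [h2, ← hb', linearMap_toMatrix_mul_basis_toMatrix, basis_toMatrix_mul_linearMap_toMatrix]

/-- Both operators are similar over ℂ to the same `N`, hence to each other, and the similarity
descends to ℝ. The spaces may differ, which allows comparison between different base points. -/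
lemma HasJordanNormalForm.exists_similarity {V V' : Type*} [AddCommGroup V] [Module ℝ V]
    [AddCommGroup V'] [Module ℝ V'] {T : V →ₗ[ℝ] V} {T' : V' →ₗ[ℝ] V'}
    {N : Matrix (Fin 4) (Fin 4) ℂ} (hT : HasJordanNormalForm T N) (hT' : HasJordanNormalForm T' N)
    (b : Module.Basis (Fin 4) ℝ V) (b' : Module.Basis (Fin 4) ℝ V') :
    ∃ Q : M4, IsUnit Q ∧ LinearMap.toMatrix b b T * Q = Q * LinearMap.toMatrix b' b' T' := by
  obtain ⟨P, hP, h⟩ := exists_similarity_to_jordan hT b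
  obtain ⟨P', ⟨P', rfl⟩, h'⟩ := exists_similarity_to_jordan hT' b'
  let Z : Matrix (Fin 4) (Fin 4) ℂ := ↑P'⁻¹
  refine exists_real_similarity (P := P * Z) (hP.mul P'⁻¹.isUnit) ?_
  have h4 : N * Z =
      Z * (LinearMap.toMatrix b' b' T').map Complex.ofRealHom := by
    rw [Units.mul_inv_eq_iff_eq_mul, mul_assoc, h', Units.inv_mul_cancel_left]
  rw [← mul_assoc, h, mul_assoc, h4, mul_assoc]

/-! ## Pseudo-orthonormal frames -/

section Frames

variable {V : Type*} [AddCommGroup V] [Module ℝ V]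

/-- Pseudo-orthonormal frames. -/
def IsFrame (g : LinearMap.BilinForm ℝ V) (e : Fin 4 → V) : Prop :=
  ∀ i j, g (e i) (e j) = if i = j then η i else 0

/-- The components `g(A(e_a,e_b)e_c,e_d)`. -/
def comps (g : LinearMap.BilinForm ℝ V) (A : CurvOp V) (e : Fin 4 → V) : Comp :=
  fun a b c d => g (A (e a) (e b) (e c)) (e d)

lemma HasNeutralSignature.exists_frame {g : LinearMap.BilinForm ℝ V} (h : HasNeutralSignature g) :
    ∃ e : Fin 4 → V, IsFrame g e := by
  obtain ⟨e, he⟩ := h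
  exact ⟨e, he⟩

namespace IsFrame

variable {g : LinearMap.BilinForm ℝ V} {e : Fin 4 → V} (he : IsFrame g e)
include he

lemma linearIndependent : LinearIndependent ℝ e := by
  rw [Fintype.linearIndependent_iff]
  intro c hc i
  have h := congrArg (fun v => η i * g v (e i)) hc
  simp only [map_sum, LinearMap.sum_apply, map_smul, LinearMap.smul_apply, he _ _, smul_eq_mul,
    mul_ite, mul_zero, Finset.sum_ite_eq', Finset.mem_univ, if_true, map_zero,
    LinearMap.zero_apply] at h
  linear_combination h - c i * η_mul_self i

variable (hV : Module.finrank ℝ V = 4)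

/-- A frame as a basis. -/
def basis : Module.Basis (Fin 4) ℝ V :=
  basisOfLinearIndependentOfCardEqFinrank he.linearIndependent (by simp [hV])

@[simp] lemma basis_apply (i : Fin 4) : he.basis hV i = e i := by simp [basis]

lemma basis_repr (v : V) (i : Fin 4) : (he.basis hV).repr v i = η i * g v (e i) := by
  conv_rhs => rw [← (he.basis hV).sum_repr v]
  simp [he _ _]
  linear_combination -((he.basis hV).repr v i) * η_mul_self i

include hV

lemma expand (v : V) : v = ∑ i, (η i * g v (e i)) • e i := by
  conv_lhs => rw [← (he.basis hV).sum_repr v]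
  simp [he.basis_repr hV]

lemma ext_form {v w : V} (h : ∀ i, g v (e i) = g w (e i)) : v = w := by
  rw [he.expand hV v, he.expand hV w]
  simp [h]

lemma bijective : Function.Bijective g := by
  have : FiniteDimensional ℝ V := Module.finite_of_finrank_pos (by simp [hV])
  have hi : Function.Injective g := by
    intro v w h
    exact he.ext_form hV fun i => by rw [h]
  refine ⟨hi, ?_⟩
  exact (LinearMap.injective_iff_surjective_of_finrank_eq_finrank
    Subspace.dual_finrank_eq.symm).1 hi

lemma form_sharp (φ : Module.Dual ℝ V) : g (sharp g φ) = φ := by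
  have hb := he.bijective hV
  simp only [sharp, dif_pos hb]
  exact (LinearEquiv.ofBijective g hb).apply_symm_apply φ

lemma metricTrace_eq (h : LinearMap.BilinForm ℝ V) :
    metricTrace g h = ∑ i, η i * h (e i) (e i) := by
  rw [metricTrace, LinearMap.trace_eq_matrix_trace ℝ (he.basis hV)]
  simp [Matrix.trace, Matrix.diag, LinearMap.toMatrix_apply, he.basis_repr hV, he.form_sharp hV]

/-- The matrix of the Jacobi operator in a frame. -/
lemma toMatrix_jacobiOp (A : CurvOp V) (x : Fin 4 → ℝ) :
    LinearMap.toMatrix (he.basis hV) (he.basis hV) (jacobiOp A (∑ i, x i • e i)) =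
      jac (comps g A e) x := by
  ext l k
  rw [LinearMap.toMatrix_apply, he.basis_repr hV, jac_apply]
  simp only [jacobiOp, basis_apply, LinearMap.flip_apply, map_sum, map_smul, LinearMap.sum_apply,
    LinearMap.smul_apply, smul_eq_mul, comps, Finset.mul_sum]
  rw [Finset.sum_comm]
  refine Finset.sum_congr rfl fun i _ => Finset.sum_congr rfl fun j _ => ?_
  ring

omit hV in
lemma form_self (x : Fin 4 → ℝ) : g (∑ i, x i • e i) (∑ i, x i • e i) = qf x := by
  simp [Fin.sum_univ_four, he _ _, qf]
  ring

end IsFrame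

/-- A congruence taking the Gram matrix to the standard one gives an orthonormal frame. -/
lemma isFrame_of_transpose {g : LinearMap.BilinForm ℝ V} {e : Fin 4 → V} {P : M4}
    (h : P.transpose * (Matrix.of fun i j => g (e i) (e j)) * P = H) :
    IsFrame g (fun a => ∑ b, P b a • e b) := by
  intro i j
  have := congrFun (congrFun h i) j
  simp only [H, Matrix.diagonal_apply] at this
  rw [← this]
  simp only [Matrix.mul_apply, Matrix.transpose_apply, Matrix.of_apply, map_sum, map_smul,
    LinearMap.sum_apply, LinearMap.smul_apply, smul_eq_mul, Finset.mul_sum, Finset.sum_mul]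
  refine Finset.sum_congr rfl fun a _ => Finset.sum_congr rfl fun b _ => ?_
  ring

/-- The change of components under a change of frame. -/
def transformComp (T : M4) (R : Comp) : Comp := fun a b c d =>
  ∑ d', ∑ c', ∑ b', ∑ a', T d' d * (T c' c * (T b' b * (T a' a * R a' b' c' d')))

lemma comps_change (g : LinearMap.BilinForm ℝ V) (A : CurvOp V) (e : Fin 4 → V) (T : M4) :
    comps g A (fun a => ∑ b, T b a • e b) = transformComp T (comps g A e) := by
  funext a b c d
  simp only [comps, transformComp, map_sum, map_smul, LinearMap.sum_apply, LinearMap.smul_apply,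
    smul_eq_mul, Finset.mul_sum]

end Frames

/-! ## Clifford structures adapted to a frame -/

section Clifford

variable {V : Type*} [AddCommGroup V] [Module ℝ V]

/-- The endomorphism with matrix `M` in the frame `e`. -/
def frameEnd (g : LinearMap.BilinForm ℝ V) (e : Fin 4 → V) (M : M4) : V →ₗ[ℝ] V :=
  ∑ a, ∑ b, (M b a * η a) • (g (e a)).smulRight (e b)

lemma frameEnd_apply (g : LinearMap.BilinForm ℝ V) (e : Fin 4 → V) (M : M4) (v : V) :
    frameEnd g e M v = ∑ a, ∑ b, (M b a * η a * g (e a) v) • e b := by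
  simp [frameEnd, smul_smul]

/-- The matrices of the three operators of a `Cliff(1,1)`-structure. The sign is the orientation. -/
def cliffMat (s : ℝ) : Fin 3 → M4 :=
  ![!![0, 1, 0, 0; -1, 0, 0, 0; 0, 0, 0, -s; 0, 0, s, 0],
    !![0, 0, 1, 0; 0, 0, 0, s; 1, 0, 0, 0; 0, s, 0, 0],
    !![0, 0, 0, -s; 0, 0, 1, 0; 0, 1, 0, 0; -s, 0, 0, 0]]

lemma mul_self_eq_one_of_sign {s : ℝ} (hs : s = 1 ∨ s = -1) : s * s = 1 := by
  rcases hs with rfl | rfl <;> norm_num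

lemma cliffMat_two_eq {s : ℝ} (hs : s = 1 ∨ s = -1) :
    cliffMat s 2 = cliffMat s 1 * cliffMat s 0 := by
  have := mul_self_eq_one_of_sign hs
  ext i j
  fin_cases i <;> fin_cases j <;> simp [cliffMat, Matrix.mul_apply, Fin.sum_univ_four, this]

lemma cliffMat_sq_zero {s : ℝ} (hs : s = 1 ∨ s = -1) : cliffMat s 0 * cliffMat s 0 = -1 := by
  have := mul_self_eq_one_of_sign hs
  ext i j
  fin_cases i <;> fin_cases j <;> simp [cliffMat, Matrix.mul_apply, Fin.sum_univ_four, this]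

lemma cliffMat_sq_one {s : ℝ} (hs : s = 1 ∨ s = -1) : cliffMat s 1 * cliffMat s 1 = 1 := by
  have := mul_self_eq_one_of_sign hs
  ext i j
  fin_cases i <;> fin_cases j <;> simp [cliffMat, Matrix.mul_apply, Fin.sum_univ_four, this]

lemma cliffMat_sq_two {s : ℝ} (hs : s = 1 ∨ s = -1) : cliffMat s 2 * cliffMat s 2 = 1 := by
  have := mul_self_eq_one_of_sign hs
  ext i j
  fin_cases i <;> fin_cases j <;> simp [cliffMat, Matrix.mul_apply, Fin.sum_univ_four, this]

lemma cliffMat_anticomm {s : ℝ} (hs : s = 1 ∨ s = -1) {k l : Fin 3} (h : k ≠ l) :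
    cliffMat s k * cliffMat s l + cliffMat s l * cliffMat s k = 0 := by
  have := mul_self_eq_one_of_sign hs
  have h01 : cliffMat s 0 * cliffMat s 1 + cliffMat s 1 * cliffMat s 0 = 0 := by
    ext i j
    fin_cases i <;> fin_cases j <;> simp [cliffMat, this]
  have h02 : cliffMat s 0 * cliffMat s 2 + cliffMat s 2 * cliffMat s 0 = 0 := by
    ext i j
    fin_cases i <;> fin_cases j <;> simp [cliffMat, this]
  have h12 : cliffMat s 1 * cliffMat s 2 + cliffMat s 2 * cliffMat s 1 = 0 := by
    ext i j
    fin_cases i <;> fin_cases j <;> simp [cliffMat, this]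
  fin_cases k <;> fin_cases l
  · exact absurd rfl h
  · exact h01
  · exact h02
  · rw [add_comm]; exact h01
  · exact absurd rfl h
  · exact h12
  · rw [add_comm]; exact h02
  · rw [add_comm]; exact h12
  · exact absurd rfl h

namespace IsFrame

variable {g : LinearMap.BilinForm ℝ V} {e : Fin 4 → V} (he : IsFrame g e)
  (hV : Module.finrank ℝ V = 4)

include he in
lemma frameEnd_frame (M : M4) (c : Fin 4) : frameEnd g e M (e c) = ∑ b, M b c • e b := by
  rw [frameEnd_apply, Finset.sum_comm]
  refine Finset.sum_congr rfl fun b _ => ?_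
  simp [he _ _, mul_assoc]

include he hV in
lemma frameEnd_comp (M M' : M4) :
    frameEnd g e M ∘ₗ frameEnd g e M' = frameEnd g e (M * M') := by
  refine (he.basis hV).ext fun c => ?_
  simp only [basis_apply, LinearMap.comp_apply, he.frameEnd_frame, map_sum, map_smul,
    Matrix.mul_apply, Finset.sum_smul, Finset.smul_sum, smul_smul]
  rw [Finset.sum_comm]
  simp only [mul_comm]

include he hV in
lemma frameEnd_one : frameEnd g e 1 = LinearMap.id := by
  refine (he.basis hV).ext fun c => ?_
  simp [he.frameEnd_frame, Matrix.one_apply]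

lemma _root_.Neutral.frameEnd_neg (M : M4) : frameEnd g e (-M) = -frameEnd g e M := by
  simp [frameEnd]

lemma _root_.Neutral.frameEnd_add (M M' : M4) :
    frameEnd g e (M + M') = frameEnd g e M + frameEnd g e M' := by
  simp [frameEnd, add_mul, add_smul, Finset.sum_add_distrib]

lemma _root_.Neutral.frameEnd_zero : frameEnd g e 0 = 0 := by
  simp [frameEnd]

include he in
lemma form_frameEnd (M : M4) (a b : Fin 4) : g (frameEnd g e M (e a)) (e b) = η b * M b a := by
  simp [he.frameEnd_frame, he _ _, mul_comm]

include he hV in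
lemma frameEnd_skew {M : M4} (hM : ∀ a b, η b * M b a = -(η a * M a b)) (x y : V) :
    g (frameEnd g e M x) y = -g x (frameEnd g e M y) := by
  have : g ∘ₗ frameEnd g e M = -(g.compl₂ (frameEnd g e M)) := by
    refine LinearMap.ext_basis (he.basis hV) (he.basis hV) fun a b => ?_
    have h2 : g (e a) (frameEnd g e M (e b)) = η a * M a b := by
      simp [he.frameEnd_frame, he _ _, mul_comm]
    simp [he.form_frameEnd, h2, hM a b]
  exact LinearMap.congr_fun₂ this x y

include he hV in
lemma isCliff11Structure {s : ℝ} (hs : s = 1 ∨ s = -1) :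
    IsCliff11Structure g (fun i => frameEnd g e (cliffMat s i)) where
  skew i := by
    refine he.frameEnd_skew hV fun a b => ?_
    fin_cases i <;> fin_cases a <;> fin_cases b <;> simp [cliffMat]
  sq_one := by
    rw [he.frameEnd_comp hV, ← he.frameEnd_one hV, ← frameEnd_neg, cliffMat_sq_zero hs]
  sq_two := by rw [he.frameEnd_comp hV, ← he.frameEnd_one hV, cliffMat_sq_one hs]
  sq_three := by rw [he.frameEnd_comp hV, ← he.frameEnd_one hV, cliffMat_sq_two hs]
  anticomm k l hkl := by
    rw [he.frameEnd_comp hV, he.frameEnd_comp hV, ← frameEnd_add, cliffMat_anticomm hs hkl,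
      frameEnd_zero]
  three_eq := by rw [he.frameEnd_comp hV, cliffMat_two_eq hs]

end IsFrame

/-! ## Modified Clifford tensors as operators -/

/-- A trilinear map as a `CurvOp`. -/
def mkCurvOp (f : V → V → V → V)
    (h1 : ∀ x x' y z, f (x + x') y z = f x y z + f x' y z)
    (h1' : ∀ (c : ℝ) x y z, f (c • x) y z = c • f x y z)
    (h2 : ∀ x y y' z, f x (y + y') z = f x y z + f x y' z)
    (h2' : ∀ (c : ℝ) x y z, f x (c • y) z = c • f x y z)
    (h3 : ∀ x y z z', f x y (z + z') = f x y z + f x y z')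
    (h3' : ∀ (c : ℝ) x y z, f x y (c • z) = c • f x y z) : CurvOp V :=
  LinearMap.mk₂ ℝ (fun x y => ⟨⟨f x y, h3 x y⟩, fun c => h3' c x y⟩)
    (fun x x' y => LinearMap.ext fun z => h1 x x' y z)
    (fun c x y => LinearMap.ext fun z => h1' c x y z)
    (fun x y y' => LinearMap.ext fun z => h2 x y y' z)
    (fun c x y => LinearMap.ext fun z => h2' c x y z)

/-- `R₀` as a `CurvOp`. -/
def R₀Op (g : LinearMap.BilinForm ℝ V) : CurvOp V :=
  mkCurvOp (R₀ g) (by intros; simp only [R₀, map_add, LinearMap.add_apply]; module)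
    (by intros; simp only [R₀, map_smul, LinearMap.smul_apply, smul_eq_mul]; module)
    (by intros; simp only [R₀, map_add, LinearMap.add_apply]; module)
    (by intros; simp only [R₀, map_smul, LinearMap.smul_apply, smul_eq_mul]; module)
    (by intros; simp only [R₀, map_add]; module)
    (by intros; simp only [R₀, map_smul, smul_eq_mul]; module)

/-- `R_Φ` as a `CurvOp`. -/
def RΦOp (g : LinearMap.BilinForm ℝ V) (Φ : V →ₗ[ℝ] V) : CurvOp V :=
  mkCurvOp (RΦ g Φ) (by intros; simp only [RΦ, map_add, LinearMap.add_apply]; module)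
    (by intros; simp only [RΦ, map_smul, LinearMap.smul_apply, smul_eq_mul]; module)
    (by intros; simp only [RΦ, map_add, LinearMap.add_apply]; module)
    (by intros; simp only [RΦ, map_smul, LinearMap.smul_apply, smul_eq_mul]; module)
    (by intros; simp only [RΦ, map_add]; module)
    (by intros; simp only [RΦ, map_smul, smul_eq_mul]; module)

/-- `modifiedClifford` as a `CurvOp`. -/
def modifiedCliffordOp (g : LinearMap.BilinForm ℝ V) (Φ : Fin 3 → V →ₗ[ℝ] V)
    (l₀ : ℝ) (l : Fin 3 → ℝ) (m : Fin 3 → Fin 3 → ℝ) : CurvOp V :=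
  l₀ • R₀Op g + ∑ i, l i • RΦOp g (Φ i)
    + ∑ i, ∑ j ∈ Finset.Ioi i, m i j • (RΦOp g (Φ i) + RΦOp g (Φ j) - RΦOp g (Φ i - Φ j))

lemma modifiedCliffordOp_apply (g : LinearMap.BilinForm ℝ V) (Φ : Fin 3 → V →ₗ[ℝ] V)
    (l₀ : ℝ) (l : Fin 3 → ℝ) (m : Fin 3 → Fin 3 → ℝ) (x y z : V) :
    modifiedCliffordOp g Φ l₀ l m x y z = modifiedClifford g Φ l₀ l m x y z := by
  simp only [modifiedCliffordOp, modifiedClifford, LinearMap.add_apply, LinearMap.sum_apply,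
    LinearMap.smul_apply, LinearMap.sub_apply]
  rfl

/-- The components of `R₀`. -/
def R₀Comp : Comp := fun a b c d =>
  (if a = c then η a else 0) * (if b = d then η b else 0)
    - (if b = c then η b else 0) * (if a = d then η a else 0)

/-- The components of the symmetric bilinear expression whose diagonal values are `R_Φ`. -/
def RΦComp (w w' : Fin 4 → Fin 4 → ℝ) : Comp := fun a b c d =>
  (w b c * w' a d + w' b c * w a d) / 2 - (w a c * w' b d + w' a c * w b d) / 2
    - (w a b * w' c d + w' a b * w c d)

/-- The components of a modified Clifford tensor. -/
def cliffComp (w : Fin 3 → Fin 4 → Fin 4 → ℝ) (l₀ : ℝ) (l : Fin 3 → ℝ) (m : Fin 3 → Fin 3 → ℝ) :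
    Comp := fun a b c d =>
  l₀ * R₀Comp a b c d + l 0 * RΦComp (w 0) (w 0) a b c d + l 1 * RΦComp (w 1) (w 1) a b c d
    + l 2 * RΦComp (w 2) (w 2) a b c d + 2 * m 0 1 * RΦComp (w 0) (w 1) a b c d
    + 2 * m 0 2 * RΦComp (w 0) (w 2) a b c d + 2 * m 1 2 * RΦComp (w 1) (w 2) a b c d

/-- R_Φ is quadratic in Φ, so R_{Φᵢ} + R_{Φⱼ} - R_{Φᵢ-Φⱼ} is twice its polarization; this is the
source of the factors 2 in `cliffComp`. -/
lemma IsFrame.comps_modifiedClifford {g : LinearMap.BilinForm ℝ V} {e : Fin 4 → V}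
    (he : IsFrame g e) (Φ : Fin 3 → V →ₗ[ℝ] V)
    (l₀ : ℝ) (l : Fin 3 → ℝ) (m : Fin 3 → Fin 3 → ℝ) :
    comps g (modifiedCliffordOp g Φ l₀ l m) e =
      cliffComp (fun i a b => g (Φ i (e a)) (e b)) l₀ l m := by
  funext a b c d
  have h0 : Finset.Ioi (0 : Fin 3) = {1, 2} := by decide
  have h1 : Finset.Ioi (1 : Fin 3) = {2} := by decide
  have h2 : Finset.Ioi (2 : Fin 3) = ∅ := by decide
  simp only [comps, modifiedCliffordOp_apply, modifiedClifford, Fin.sum_univ_three, h0, h1, h2,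
    Finset.sum_singleton, Finset.sum_empty, map_zero, LinearMap.zero_apply, Finset.sum_pair (show (1 : Fin 3) ≠ 2 by decide), R₀,
    RΦ, map_add, map_sub, map_smul, LinearMap.add_apply, LinearMap.sub_apply, LinearMap.smul_apply,
    smul_eq_mul, he _ _, cliffComp, R₀Comp, RΦComp]
  ring

lemma isAlgCurv_R₀Comp : IsAlgCurv R₀Comp where
  anti₁ a b c d := by simp only [R₀Comp]; ring
  anti₂ c d a b := by simp only [R₀Comp]; ring
  bianchi a b c d := by
    have h : ∀ i j : Fin 4, (if i = j then η i else 0) = if j = i then η j else 0 := by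
      intro i j
      by_cases hij : i = j
      · simp [hij]
      · simp [hij, Ne.symm hij]
    simp only [R₀Comp]
    rw [h c a, h b a, h c b]
    ring

lemma isAlgCurv_RΦComp {w w' : Fin 4 → Fin 4 → ℝ} (h : ∀ a b, w b a = -w a b)
    (h' : ∀ a b, w' b a = -w' a b) : IsAlgCurv (RΦComp w w') where
  anti₁ a b c d := by simp only [RΦComp, h a b, h' a b]; ring
  anti₂ c d a b := by simp only [RΦComp, h c d, h' c d]; ring
  bianchi a b c d := by
    simp only [RΦComp, h a b, h' a b, h c a, h' c a, h b c, h' b c]; ring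

lemma isAlgCurv_cliffComp {w : Fin 3 → Fin 4 → Fin 4 → ℝ} (h : ∀ i a b, w i b a = -w i a b)
    (l₀ : ℝ) (l : Fin 3 → ℝ) (m : Fin 3 → Fin 3 → ℝ) : IsAlgCurv (cliffComp w l₀ l m) := by
  have h0 := isAlgCurv_R₀Comp
  have k : ∀ i j, IsAlgCurv (RΦComp (w i) (w j)) := fun i j => isAlgCurv_RΦComp (h i) (h j)
  constructor
  · intro a b c d
    simp only [cliffComp, h0.anti₁ a b, (k _ _).anti₁ a b]; ring
  · intro c d a b
    simp only [cliffComp, h0.anti₂ c d, (k _ _).anti₂ c d]; ring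
  · intro a b c d
    simp only [cliffComp]
    linear_combination l₀ * h0.bianchi a b c d + l 0 * (k 0 0).bianchi a b c d
      + l 1 * (k 1 1).bianchi a b c d + l 2 * (k 2 2).bianchi a b c d
      + 2 * m 0 1 * (k 0 1).bianchi a b c d + 2 * m 0 2 * (k 0 2).bianchi a b c d
      + 2 * m 1 2 * (k 1 2).bianchi a b c d

/-- The diagonal coefficients of a half flat tensor. -/
def cliffDiag (R : Comp) : Fin 3 → ℝ := ![-R 0 1 0 1 / 3, -R 0 2 0 2 / 3, -R 0 3 0 3 / 3]

/-- The off-diagonal coefficients of a half flat tensor. -/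
def cliffOff (s : ℝ) (R : Comp) : Fin 3 → Fin 3 → ℝ :=
  ![![0, -R 0 1 0 2 / 3, s * R 0 1 0 3 / 3], ![0, 0, s * R 0 2 0 3 / 3], ![0, 0, 0]]

/-- Both sides are half flat of orientation `s`. The six free components give the three diagonal and
the three mixed coefficients, and the factor 1/3 comes from R_Φ(x, Φx, x, Φx), in which all three
terms of R_Φ contribute with the same sign. -/
lemma IsHalfFlat.eq_cliffComp {s : ℝ} (hs : s = 1 ∨ s = -1) {R : Comp} (hR : IsAlgCurv R)
    (h : IsHalfFlat s R) :
    R = cliffComp (fun i a b => η b * cliffMat s i b a) 0 (cliffDiag R) (cliffOff s R) := by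
  have hC : IsAlgCurv
      (cliffComp (fun i a b => η b * cliffMat s i b a) 0 (cliffDiag R) (cliffOff s R)) := by
    refine isAlgCurv_cliffComp (fun i a b => ?_) _ _ _
    fin_cases i <;> fin_cases a <;> fin_cases b <;> simp [cliffMat]
  funext a b c d
  rw [← sub_eq_zero]
  obtain ⟨e1, e2, e3, e4, e5, e6, e7, e8, e9, e10, e11, e12, e13, e14, e15⟩ := h
  refine (hR.sub hC).eq_zero ?_ ?_ ?_ ?_ ?_ ?_ ?_ ?_ ?_ ?_ ?_ ?_ ?_ ?_ ?_ ?_ ?_ ?_ ?_ ?_ ?_ a b c d <;>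
    try simp only [e1, e2, e3, e4, e5, e6, e7, e8, e9, e10, e11, e12, e13, e14, e15]
  all_goals rcases hs with rfl | rfl <;>
    simp [cliffComp, R₀Comp, RΦComp, cliffMat, cliffDiag, cliffOff] <;> ring

/-- Half flat tensors are modified Clifford tensors. -/
lemma IsFrame.eq_modifiedClifford {g : LinearMap.BilinForm ℝ V} {e : Fin 4 → V}
    (he : IsFrame g e) (hV : Module.finrank ℝ V = 4) {s : ℝ} (hs : s = 1 ∨ s = -1) {A : CurvOp V}
    (hR : IsAlgCurv (comps g A e)) (h : IsHalfFlat s (comps g A e)) (x y z : V) :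
    A x y z = modifiedClifford g (fun i => frameEnd g e (cliffMat s i)) 0
      (cliffDiag (comps g A e)) (cliffOff s (comps g A e)) x y z := by
  rw [← modifiedCliffordOp_apply]
  have h1 := he.comps_modifiedClifford (fun i => frameEnd g e (cliffMat s i)) 0
    (cliffDiag (comps g A e)) (cliffOff s (comps g A e))
  simp only [he.form_frameEnd] at h1
  rw [← h.eq_cliffComp hs hR] at h1
  have h2 : modifiedCliffordOp g (fun i => frameEnd g e (cliffMat s i)) 0
      (cliffDiag (comps g A e)) (cliffOff s (comps g A e)) = A := by
    refine (he.basis hV).ext fun a => (he.basis hV).ext fun b => (he.basis hV).ext fun c => ?_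
    refine he.ext_form hV fun d => ?_
    simp only [IsFrame.basis_apply]
    exact congrFun (congrFun (congrFun (congrFun h1 a) b) c) d
  rw [h2]

end Clifford

/-! ## Components of the Weyl tensor -/

/-- The Gram matrix of a frame. -/
def δη (a b : Fin 4) : ℝ := if a = b then η a else 0

lemma δη_symm (a b : Fin 4) : δη a b = δη b a := by
  by_cases h : a = b
  · simp [h]
  · simp [δη, h, Ne.symm h]

/-- The Ricci tensor in a frame. -/
def ricComp (R : Comp) (b d : Fin 4) : ℝ := ∑ a, η a * R a b a d

/-- The scalar curvature in a frame. -/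
def scalComp (R : Comp) : ℝ := ∑ b, η b * ricComp R b b

/-- The Kulkarni-Nomizu product in a frame. -/
def knComp (h k : Fin 4 → Fin 4 → ℝ) : Comp := fun x y z v =>
  h x z * k y v + h y v * k x z - h x v * k y z - h y z * k x v

/-- The Weyl tensor in a frame. -/
def weylComp (R : Comp) : Comp := fun a b c d =>
  R a b c d - scalComp R / 24 * knComp δη δη a b c d
    - 1 / 2 * knComp (fun i j => ricComp R i j - scalComp R / 4 * δη i j) δη a b c d

lemma isAlgCurv_knComp {h k : Fin 4 → Fin 4 → ℝ} (hh : ∀ a b, h a b = h b a)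
    (hk : ∀ a b, k a b = k b a) : IsAlgCurv (knComp h k) where
  anti₁ a b c d := by simp only [knComp]; ring
  anti₂ c d a b := by simp only [knComp]; ring
  bianchi a b c d := by
    simp only [knComp]
    rw [hh c a, hh b a, hh c b, hk c a, hk b a, hk c b]
    ring

lemma isAlgCurv_weylComp {R : Comp} (h : IsAlgCurv R) : IsAlgCurv (weylComp R) := by
  have h1 := isAlgCurv_knComp δη_symm δη_symm
  have h2 := isAlgCurv_knComp (h := fun i j => ricComp R i j - scalComp R / 4 * δη i j) (k := δη)
    (fun a b => by
      have : ricComp R a b = ricComp R b a :=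
        Finset.sum_congr rfl fun i _ => by rw [h.pair i b i a]
      rw [this, δη_symm a b]) δη_symm
  constructor
  · intro a b c d
    simp only [weylComp, h.anti₁ a b, h1.anti₁ a b, h2.anti₁ a b]; ring
  · intro c d a b
    simp only [weylComp, h.anti₂ c d, h1.anti₂ c d, h2.anti₂ c d]; ring
  · intro a b c d
    simp only [weylComp]
    linear_combination h.bianchi a b c d - scalComp R / 24 * h1.bianchi a b c d
      - 1 / 2 * h2.bianchi a b c d

/-- The Weyl tensor is trace free. -/
lemma ricComp_weylComp {R : Comp} (h : IsAlgCurv R) : ricComp (weylComp R) 0 0 = 0 := by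
  simp only [ricComp, weylComp, knComp, scalComp, Fin.sum_univ_four, δη, η_zero, η_one, η_two,
    η_three, h.diag₁, Fin.isValue, if_true, h.anti₁ 0 1, h.anti₁ 0 2, h.anti₁ 0 3, h.anti₂ 0 1,
    h.anti₂ 0 2, h.anti₂ 0 3]
  simp
  ring

section

variable {V : Type*} [AddCommGroup V] [Module ℝ V]

lemma IsFrame.comps_weylOp {g : LinearMap.BilinForm ℝ V} {e : Fin 4 → V} (he : IsFrame g e)
    (hV : Module.finrank ℝ V = 4) (A : CurvOp V) :
    comps g (weylOp g A) e = weylComp (comps g A e) := by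
  have hric : ∀ b d, ricci g (lower g A) (e b) (e d) = ricComp (comps g A e) b d := fun b d => by
    simp [ricci, he.metricTrace_eq hV, slots13, ricComp, comps, lower]
  have hscal : scal g (lower g A) = scalComp (comps g A e) := by
    simp [scal, he.metricTrace_eq hV, hric, scalComp]
  have hraise : ∀ (T : Tensor4 V) x y z v, g (raise g T x y z) v = T x y z v := fun T x y z v => by
    simp [raise, he.form_sharp hV]
  funext a b c d
  have hlow : lower g A (e a) (e b) (e c) (e d) = comps g A e a b c d := rfl
  have hδ : ∀ i j, g (e i) (e j) = δη i j := he
  change g (weylOp g A (e a) (e b) (e c)) (e d) = _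
  simp only [weylOp, hraise, weyl4, LinearMap.mk₂_apply, LinearMap.sub_apply, LinearMap.smul_apply,
    kulkarniNomizu, hlow, hδ, hric, hscal, weylComp, knComp, smul_eq_mul]

end

/-! ## Calculus of bilinear expressions -/

section Calculus

variable {E F F' F'' : Type*} [NormedAddCommGroup E] [NormedSpace ℝ E]
  [NormedAddCommGroup F] [NormedSpace ℝ F] [NormedAddCommGroup F'] [NormedSpace ℝ F']
  [NormedAddCommGroup F''] [NormedSpace ℝ F'']

lemma fderiv_lin_apply {L : E → F →L[ℝ] F'} {a : E → F} {u : E} (hL : DifferentiableAt ℝ L u)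
    (ha : DifferentiableAt ℝ a u) (x : E) :
    fderiv ℝ (fun y => L y (a y)) u x = fderiv ℝ L u x (a u) + L u (fderiv ℝ a u x) := by
  rw [fderiv_clm_apply hL ha]
  simp [add_comm]

lemma fderiv_lin_const {L : E → F →L[ℝ] F'} {u : E} (hL : DifferentiableAt ℝ L u) (a : F) (x : E) :
    fderiv ℝ (fun y => L y a) u x = fderiv ℝ L u x a := by
  rw [fderiv_lin_apply hL (differentiableAt_const a)]
  simp

lemma fderiv_bilin_apply {B : E → F →L[ℝ] F' →L[ℝ] F''} {a : E → F} {b : E → F'} {u : E}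
    (hB : DifferentiableAt ℝ B u) (ha : DifferentiableAt ℝ a u) (hb : DifferentiableAt ℝ b u)
    (x : E) :
    fderiv ℝ (fun y => B y (a y) (b y)) u x =
      fderiv ℝ B u x (a u) (b u) + B u (fderiv ℝ a u x) (b u) + B u (a u) (fderiv ℝ b u x) := by
  rw [fderiv_lin_apply (L := fun y => B y (a y)) (hB.clm_apply ha) hb, fderiv_lin_apply hB ha]
  simp

lemma fderiv_bilin_const {B : E → F →L[ℝ] F' →L[ℝ] F''} {u : E}
    (hB : DifferentiableAt ℝ B u) (a : F) (b : F') (x : E) :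
    fderiv ℝ (fun y => B y a b) u x = fderiv ℝ B u x a b := by
  rw [fderiv_bilin_apply hB (differentiableAt_const a) (differentiableAt_const b)]
  simp

lemma smoothNear_clm {ι : Type*} [Fintype ι] (b : Module.Basis ι ℝ F) {f : E → F →L[ℝ] F'} {u : E}
    (h : ∀ i, SmoothNear (fun y => f y (b i)) u) : SmoothNear f u := by
  have : FiniteDimensional ℝ F := b.finiteDimensional_of_finite
  have key : f = fun y => ∑ i, ContinuousLinearMap.smulRightL ℝ F F'
      (LinearMap.toContinuousLinearMap (b.coord i)) (f y (b i)) := by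
    funext y
    ext v
    conv_lhs => rw [← b.sum_repr v, map_sum]
    simp [-Module.Basis.sum_repr]
  rw [key]
  exact SmoothNear.sum fun i _ => (h i).clm _

lemma SmoothNear.differentiableAt {f : E → F} {x : E} (h : SmoothNear f x) :
    DifferentiableAt ℝ f x := h.contDiffAt.differentiableAt (by simp)

end Calculus

/-! ## The Levi-Civita connection in coordinates -/

/-- Near `u`, the field `G` is smooth, symmetric and of neutral signature. -/
def IsMetricNear (G : E4 → E4 →L[ℝ] E4 →L[ℝ] ℝ) (u : E4) : Prop :=
  ∀ᶠ y in 𝓝 u, ContDiffAt ℝ ∞ G y ∧ (∀ v w, G y v w = G y w v) ∧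
    ∃ e, IsFrame (G y).toLinearMap₁₂ e

lemma finrank_E4 : Module.finrank ℝ E4 = 4 := by simp

/-- A basis of the model space. -/
def stdBasis : Module.Basis (Fin 4) ℝ E4 := Module.finBasisOfFinrankEq ℝ E4 finrank_E4

namespace IsMetricNear

variable {G : E4 → E4 →L[ℝ] E4 →L[ℝ] ℝ} {u : E4} (h : IsMetricNear G u)
include h

lemma eventually : ∀ᶠ y in 𝓝 u, IsMetricNear G y := eventually_eventually_nhds.2 h

lemma smoothNear : SmoothNear G u := h.mono fun _ hy => hy.1

lemma symm (v w : E4) : G u v w = G u w v := h.self_of_nhds.2.1 v w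

lemma exists_frame : ∃ e, IsFrame (G u).toLinearMap₁₂ e := h.self_of_nhds.2.2

lemma ext {v w : E4} (hvw : ∀ z, G u v z = G u w z) : v = w := by
  obtain ⟨e, he⟩ := h.exists_frame
  exact he.ext_form finrank_E4 fun i => hvw _

lemma fderiv_symm (x v w : E4) : fderiv ℝ G u x v w = fderiv ℝ G u x w v := by
  rw [← fderiv_bilin_const h.smoothNear.differentiableAt,
    ← fderiv_bilin_const h.smoothNear.differentiableAt]
  have : (fun y => G y v w) =ᶠ[𝓝 u] fun y => G y w v :=
    h.eventually.mono fun y hy => hy.symm v w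
  rw [this.fderiv_eq]

/-- Frames extend to smooth frames. -/
lemma exists_smooth_frame {e : Fin 4 → E4} (he : IsFrame (G u).toLinearMap₁₂ e) :
    ∃ X : E4 → Fin 4 → E4, (∀ a, SmoothNear (fun y => X y a) u) ∧ X u = e ∧
      ∀ᶠ y in 𝓝 u, IsFrame (G y).toLinearMap₁₂ (X y) := by
  obtain ⟨P, hP, hP1, hP2⟩ := exists_orthonormalizing
    (Y := fun y => Matrix.of fun i j => G y (e i) (e j)) (x := u)
    (smoothNear_matrix.2 fun i j => (h.smoothNear.clm_apply (smoothNear_const _ _)).clm_apply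
      (smoothNear_const _ _))
    (by ext i j; exact he i j)
    (h.eventually.mono fun y hy => by ext i j; exact hy.symm _ _)
  refine ⟨fun y a => ∑ b, P y b a • e b, fun a => SmoothNear.sum fun b _ =>
    (smoothNear_matrix.1 hP b a).smul (smoothNear_const _ _), ?_, ?_⟩
  · funext a
    simp [hP1, Matrix.one_apply]
  · filter_upwards [hP2] with y hy
    exact isFrame_of_transpose hy

lemma christoffel_spec (v w z : E4) : G u (christoffel G u v w) z =
    1 / 2 * (fderiv ℝ G u v w z + fderiv ℝ G u w v z - fderiv ℝ G u z v w) := by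
  obtain ⟨e, he⟩ := h.exists_frame
  have := LinearMap.congr_fun (he.form_sharp finrank_E4 (christoffelLower G u v w)) z
  refine this.trans ?_
  simp [christoffelLower]

lemma christoffel_symm (v w : E4) : christoffel G u v w = christoffel G u w v :=
  h.ext fun z => by
    rw [h.christoffel_spec, h.christoffel_spec, h.fderiv_symm z v w]; ring

/-- Metric compatibility of the connection, for constant vector fields. -/
lemma fderiv_eq (x v w : E4) :
    fderiv ℝ G u x v w = G u (christoffel G u x v) w + G u v (christoffel G u x w) := by
  rw [h.symm v, h.christoffel_spec, h.christoffel_spec, h.fderiv_symm v x w, h.fderiv_symm w x v,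
    h.fderiv_symm x w v]
  ring

/-- Expanding Γ(v,w) in a smooth orthonormal frame expresses it through the Koszul formula, so no
smoothness of `sharp` is needed. -/
lemma smoothNear_christoffel : SmoothNear (christoffel G) u := by
  obtain ⟨e, he⟩ := h.exists_frame
  obtain ⟨X, hX, -, hXf⟩ := h.exists_smooth_frame he
  have hD := h.smoothNear.fderiv
  refine smoothNear_clm stdBasis fun i => smoothNear_clm stdBasis fun j => ?_
  set v := stdBasis i
  set w := stdBasis j
  have hs : SmoothNear (fun y => ∑ a, (η a * (1 / 2 * (fderiv ℝ G y v w (X y a)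
      + fderiv ℝ G y w v (X y a) - fderiv ℝ G y (X y a) v w))) • X y a) u := by
    refine SmoothNear.sum fun a _ => SmoothNear.smul (SmoothNear.mul (smoothNear_const _ _)
      (SmoothNear.mul (smoothNear_const _ _) (SmoothNear.sub (SmoothNear.add ?_ ?_) ?_))) (hX a)
    · exact ((hD.clm_apply (smoothNear_const _ _)).clm_apply (smoothNear_const _ _)).clm_apply (hX a)
    · exact ((hD.clm_apply (smoothNear_const _ _)).clm_apply (smoothNear_const _ _)).clm_apply (hX a)
    · exact ((hD.clm_apply (hX a)).clm_apply (smoothNear_const _ _)).clm_apply (smoothNear_const _ _)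
  refine hs.congr ?_
  filter_upwards [h.eventually, hXf] with y hy hf
  conv_lhs => rw [hf.expand finrank_E4 (christoffel G y v w)]
  refine Finset.sum_congr rfl fun a _ => ?_
  rw [← hy.christoffel_spec]
  rfl

lemma fderiv_christoffel_symm (x v w : E4) :
    fderiv ℝ (christoffel G) u x v w = fderiv ℝ (christoffel G) u x w v := by
  have hd := h.smoothNear_christoffel.differentiableAt
  rw [← fderiv_bilin_const hd, ← fderiv_bilin_const hd]
  have : (fun y => christoffel G y v w) =ᶠ[𝓝 u] fun y => christoffel G y w v :=
    h.eventually.mono fun y hy => hy.christoffel_symm v w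
  rw [this.fderiv_eq]

end IsMetricNear

lemma coordCurvature_apply (Γ : E4 → E4 →L[ℝ] E4 →L[ℝ] E4) (u x y z : E4) :
    coordCurvature Γ u x y z = fderiv ℝ Γ u x y z - fderiv ℝ Γ u y x z
      + Γ u x (Γ u y z) - Γ u y (Γ u x z) := by
  simp [coordCurvature]

lemma fderiv_fderiv_symm {F : Type*} [NormedAddCommGroup F] [NormedSpace ℝ F] {f : E4 → F} {u : E4}
    (hf : SmoothNear f u) (x y : E4) :
    fderiv ℝ (fderiv ℝ f) u x y = fderiv ℝ (fderiv ℝ f) u y x :=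
  hf.contDiffAt.isSymmSndFDerivAt (by
    rw [minSmoothness_of_isRCLikeNormedField]; exact ENat.LEInfty.out) x y

namespace IsMetricNear

variable {G : E4 → E4 →L[ℝ] E4 →L[ℝ] ℝ} {u : E4} (h : IsMetricNear G u)
include h

/-- Differentiate G(z,w) twice for constant z, w, using metric compatibility each time.
Antisymmetrizing the second derivatives gives 0 on one side and G(R(x,y)z,w) + G(z,R(x,y)w) on the
other. -/
lemma coordCurvature_skew (x y z w : E4) :
    G u (coordCurvature (christoffel G) u x y z) w =
      -G u (coordCurvature (christoffel G) u x y w) z := by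
  have hG := h.smoothNear.differentiableAt
  have hΓ := h.smoothNear_christoffel
  have hc : ∀ v a, DifferentiableAt ℝ (fun y => christoffel G y v a) u := fun v a =>
    ((hΓ.clm_apply (smoothNear_const _ _)).clm_apply (smoothNear_const _ _)).differentiableAt
  have hf : SmoothNear (fun y => G y z w) u :=
    (h.smoothNear.clm_apply (smoothNear_const _ _)).clm_apply (smoothNear_const _ _)
  have hD : ∀ x v : E4, fderiv ℝ (fderiv ℝ fun y => G y z w) u x v =
      fderiv ℝ G u x (christoffel G u v z) w + G u (fderiv ℝ (christoffel G) u x v z) w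
        + (fderiv ℝ G u x z (christoffel G u v w)
          + G u z (fderiv ℝ (christoffel G) u x v w)) := by
    intro x v
    have e1 : (fun y => fderiv ℝ (fun y => G y z w) y v) =ᶠ[𝓝 u] fun y =>
        G y (christoffel G y v z) w + G y z (christoffel G y v w) := by
      filter_upwards [h.eventually] with y hy
      rw [fderiv_bilin_const hy.smoothNear.differentiableAt, hy.fderiv_eq]
    rw [← fderiv_lin_const hf.fderiv.differentiableAt, e1.fderiv_eq, fderiv_fun_add, add_apply,
      fderiv_bilin_apply hG (hc v z) (differentiableAt_const w),
      fderiv_bilin_apply hG (differentiableAt_const z) (hc v w),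
      fderiv_bilin_const hΓ.differentiableAt, fderiv_bilin_const hΓ.differentiableAt]
    · simp
    · exact (hG.clm_apply (hc v z)).clm_apply (differentiableAt_const w)
    · exact (hG.clm_apply (differentiableAt_const z)).clm_apply (hc v w)
  have k := fderiv_fderiv_symm hf x y
  simp only [hD, h.fderiv_eq] at k
  rw [coordCurvature_apply, coordCurvature_apply, h.symm _ z]
  simp only [map_add, map_sub, add_apply, sub_apply]
  linear_combination k

/-- The first Bianchi identity comes from the symmetry of Γ and of its derivative in the two lower
arguments, that is, from vanishing torsion. -/
lemma isAlgCurv_comps (e : Fin 4 → E4) :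
    IsAlgCurv (comps (G u).toLinearMap₁₂ (coordCurvature (christoffel G) u) e) where
  anti₁ a b c d := by
    change G u _ _ = -G u _ _
    rw [coordCurvature_apply, coordCurvature_apply, ← neg_apply, ← map_neg]
    congr 2
    abel
  anti₂ c d a b := h.coordCurvature_skew _ _ _ _
  bianchi a b c d := by
    change G u _ _ + G u _ _ + G u _ _ = 0
    rw [← add_apply, ← map_add, ← add_apply, ← map_add]
    have : coordCurvature (christoffel G) u (e a) (e b) (e c)
        + coordCurvature (christoffel G) u (e b) (e c) (e a)
        + coordCurvature (christoffel G) u (e c) (e a) (e b) = 0 := by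
      simp only [coordCurvature_apply]
      rw [h.fderiv_christoffel_symm (e a) (e c) (e b), h.fderiv_christoffel_symm (e b) (e a) (e c),
        h.fderiv_christoffel_symm (e c) (e b) (e a), h.christoffel_symm (e c) (e b),
        h.christoffel_symm (e a) (e c), h.christoffel_symm (e b) (e a)]
      abel
    rw [this]
    simp

lemma smoothNear_coordCurvature {x y z : E4 → E4} (hx : SmoothNear x u) (hy : SmoothNear y u)
    (hz : SmoothNear z u) :
    SmoothNear (fun p => coordCurvature (christoffel G) p (x p) (y p) (z p)) u := by
  simp only [coordCurvature_apply]
  have hΓ := h.smoothNear_christoffel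
  have hD := hΓ.fderiv
  exact ((((hD.clm_apply hx).clm_apply hy).clm_apply hz).sub
    (((hD.clm_apply hy).clm_apply hx).clm_apply hz)).add
    ((hΓ.clm_apply hx).clm_apply ((hΓ.clm_apply hy).clm_apply hz)) |>.sub
    ((hΓ.clm_apply hy).clm_apply ((hΓ.clm_apply hx).clm_apply hz))

end IsMetricNear

/-! ## Change of coordinates -/

section Naturality

variable {G G' : E4 → E4 →L[ℝ] E4 →L[ℝ] ℝ} {τ : E4 → E4} {u : E4}

/-- Differentiating G' = τ*G and inserting the result into the Koszul formula leaves the usual law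
with its second-derivative term. Nondegeneracy of G and surjectivity of dτ allow testing against
vectors dτ(z) only. -/
lemma christoffel_naturality (hG : IsMetricNear G (τ u)) (hG' : IsMetricNear G' u)
    (hτ : SmoothNear τ u) (hpull : ∀ᶠ y in 𝓝 u, ∀ v w, G' y v w =
      G (τ y) (fderiv ℝ τ y v) (fderiv ℝ τ y w))
    (hsurj : Function.Surjective (fderiv ℝ τ u)) (v w : E4) :
    fderiv ℝ τ u (christoffel G' u v w) = fderiv ℝ (fderiv ℝ τ) u v w
      + christoffel G (τ u) (fderiv ℝ τ u v) (fderiv ℝ τ u w) := by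
  have hD : ∀ x v w, fderiv ℝ G' u x v w =
      fderiv ℝ G (τ u) (fderiv ℝ τ u x) (fderiv ℝ τ u v) (fderiv ℝ τ u w)
      + G (τ u) (fderiv ℝ (fderiv ℝ τ) u x v) (fderiv ℝ τ u w)
      + G (τ u) (fderiv ℝ τ u v) (fderiv ℝ (fderiv ℝ τ) u x w) := by
    intro x v w
    rw [← fderiv_bilin_const hG'.smoothNear.differentiableAt]
    have e1 : (fun y => G' y v w) =ᶠ[𝓝 u] fun y =>
        G (τ y) (fderiv ℝ τ y v) (fderiv ℝ τ y w) := hpull.mono fun y hy => hy v w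
    have hτ' : ∀ v, DifferentiableAt ℝ (fun y => fderiv ℝ τ y v) u := fun v =>
      (hτ.fderiv.clm_apply (smoothNear_const _ _)).differentiableAt
    rw [e1.fderiv_eq, fderiv_bilin_apply (B := fun y => G (τ y))
      (hG.smoothNear.comp hτ).differentiableAt (hτ' v) (hτ' w),
      fderiv_lin_const hτ.fderiv.differentiableAt, fderiv_lin_const hτ.fderiv.differentiableAt]
    congr 4
    have := fderiv_comp (𝕜 := ℝ) u (g := G) (f := τ) hG.smoothNear.differentiableAt
      hτ.differentiableAt
    exact congrArg (fun L => L x) this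
  refine hG.ext fun z' => ?_
  obtain ⟨z, rfl⟩ := hsurj z'
  have h1 := hpull.self_of_nhds (christoffel G' u v w) z
  rw [hG'.christoffel_spec, hD, hD, hD] at h1
  rw [← h1, map_add, add_apply, hG.christoffel_spec,
    fderiv_fderiv_symm hτ w v, fderiv_fderiv_symm hτ z v, fderiv_fderiv_symm hτ z w,
    hG.symm (fderiv ℝ τ u w), hG.symm (fderiv ℝ τ u v)]
  ring

/-- Differentiate the transformation law of the Christoffel symbols and antisymmetrize: the second
and third derivatives of τ cancel by symmetry. -/
lemma coordCurvature_naturality (hG : IsMetricNear G (τ u)) (hG' : IsMetricNear G' u)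
    (hτ : SmoothNear τ u) (hpull : ∀ᶠ y in 𝓝 u, ∀ v w, G' y v w =
      G (τ y) (fderiv ℝ τ y v) (fderiv ℝ τ y w))
    (hsurj : ∀ᶠ y in 𝓝 u, Function.Surjective (fderiv ℝ τ y)) (x y z : E4) :
    fderiv ℝ τ u (coordCurvature (christoffel G') u x y z) =
      coordCurvature (christoffel G) (τ u) (fderiv ℝ τ u x) (fderiv ℝ τ u y)
        (fderiv ℝ τ u z) := by
  have hΓ' := hG'.smoothNear_christoffel
  have hΓ := hG.smoothNear_christoffel
  have hN : ∀ᶠ p in 𝓝 u, ∀ v w, fderiv ℝ τ p (christoffel G' p v w) =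
      fderiv ℝ (fderiv ℝ τ) p v w
        + christoffel G (τ p) (fderiv ℝ τ p v) (fderiv ℝ τ p w) := by
    filter_upwards [hτ.continuousAt.eventually hG.eventually, hG'.eventually,
      eventually_eventually_nhds.2 hτ, eventually_eventually_nhds.2 hpull, hsurj]
      with p h1 h2 h3 h4 h5 using christoffel_naturality h1 h2 h3 h4 h5
  have hτ1 : DifferentiableAt ℝ (fderiv ℝ τ) u := hτ.fderiv.differentiableAt
  have hτ2 : DifferentiableAt ℝ (fderiv ℝ (fderiv ℝ τ)) u := hτ.fderiv.fderiv.differentiableAt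
  have hD : ∀ x y z : E4, fderiv ℝ (fderiv ℝ τ) u x (christoffel G' u y z)
      + fderiv ℝ τ u (fderiv ℝ (christoffel G') u x y z) =
      fderiv ℝ (fderiv ℝ (fderiv ℝ τ)) u x y z
      + (fderiv ℝ (christoffel G) (τ u) (fderiv ℝ τ u x) (fderiv ℝ τ u y) (fderiv ℝ τ u z)
        + christoffel G (τ u) (fderiv ℝ (fderiv ℝ τ) u x y) (fderiv ℝ τ u z)
        + christoffel G (τ u) (fderiv ℝ τ u y) (fderiv ℝ (fderiv ℝ τ) u x z)) := by
    intro x y z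
    have e1 : (fun p => fderiv ℝ τ p (christoffel G' p y z)) =ᶠ[𝓝 u] fun p =>
        fderiv ℝ (fderiv ℝ τ) p y z
          + christoffel G (τ p) (fderiv ℝ τ p y) (fderiv ℝ τ p z) := hN.mono fun p hp => hp y z
    have hτ' : ∀ v, DifferentiableAt ℝ (fun y => fderiv ℝ τ y v) u := fun v =>
      (hτ.fderiv.clm_apply (smoothNear_const _ _)).differentiableAt
    have hΓτ := (hΓ.comp hτ).differentiableAt
    have h2 := DFunLike.congr_fun (e1.fderiv_eq (𝕜 := ℝ)) x
    rw [fderiv_lin_apply hτ1 ((hΓ'.clm_apply (smoothNear_const _ _)).clm_apply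
      (smoothNear_const _ _)).differentiableAt,
      fderiv_bilin_const hΓ'.differentiableAt, fderiv_fun_add, add_apply,
      fderiv_bilin_const hτ2,
      fderiv_bilin_apply (B := fun y => christoffel G (τ y)) hΓτ (hτ' y) (hτ' z),
      fderiv_lin_const hτ1, fderiv_lin_const hτ1] at h2
    · rw [h2]
      congr 5
      have := fderiv_comp (𝕜 := ℝ) u (g := christoffel G) (f := τ) hΓ.differentiableAt
        hτ.differentiableAt
      exact congrArg (fun L => L x) this
    · exact ((hτ.fderiv.fderiv.clm_apply (smoothNear_const _ _)).clm_apply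
        (smoothNear_const _ _)).differentiableAt
    · exact (hΓτ.clm_apply (hτ' y)).clm_apply (hτ' z)
  have h1 := hD x y z
  have h2 := hD y x z
  have h3 : fderiv ℝ (fderiv ℝ (fderiv ℝ τ)) u x y z =
      fderiv ℝ (fderiv ℝ (fderiv ℝ τ)) u y x z :=
    DFunLike.congr_fun (fderiv_fderiv_symm hτ.fderiv x y) z
  have h4 := fderiv_fderiv_symm hτ x y
  have hNu := hN.self_of_nhds
  have h1' := eq_sub_of_add_eq' h1
  have h2' := eq_sub_of_add_eq' h2
  simp only [coordCurvature_apply, map_add, map_sub, h1', h2', h3, h4, hNu]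
  abel

end Naturality

/-! ## The preferred coordinates of a manifold -/

section Coordinates

variable {M : Type*} [TopologicalSpace M] [ChartedSpace E4 M]

lemma finrank_tangentSpace (p : M) : Module.finrank ℝ (TangentSpace (𝓡 4) p) = 4 := finrank_E4

/-- The differential of the preferred chart around `P`, as a map of `ℝ⁴`. -/
def chartD (P p : M) : E4 →L[ℝ] E4 := mfderiv (𝓡 4) 𝓘(ℝ, E4) (extChartAt (𝓡 4) P) p

/-- The differential of the inverse of the preferred chart around `P`, as a map of `ℝ⁴`. -/
def chartDInv (P : M) (u : E4) : E4 →L[ℝ] E4 :=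
  mfderiv 𝓘(ℝ, E4) (𝓡 4) (extChartAt (𝓡 4) P).symm u

lemma chartDInv_eq_mfderivWithin (P : M) (u : E4) : chartDInv P u =
    mfderivWithin 𝓘(ℝ, E4) (𝓡 4) (extChartAt (𝓡 4) P).symm (Set.range (𝓡 4)) u := by
  rw [ModelWithCorners.range_eq_univ, mfderivWithin_univ]; rfl

lemma eventually_mem_source {P Q : M} {u : E4} (hu : u ∈ (extChartAt (𝓡 4) P).target)
    (hQ : (extChartAt (𝓡 4) P).symm u ∈ (extChartAt (𝓡 4) Q).source) :
    ∀ᶠ y in 𝓝 u, y ∈ (extChartAt (𝓡 4) P).target ∧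
      (extChartAt (𝓡 4) P).symm y ∈ (extChartAt (𝓡 4) Q).source :=
  ((isOpen_extChartAt_target P).eventually_mem hu).and
    ((continuousAt_extChartAt_symm'' hu).eventually_mem ((isOpen_extChartAt_source Q).mem_nhds hQ))

variable [IsManifold (𝓡 4) ∞ M]

lemma chartD_chartDInv {P : M} {u : E4} (hu : u ∈ (extChartAt (𝓡 4) P).target) (v : E4) :
    chartD P ((extChartAt (𝓡 4) P).symm u) (chartDInv P u v) = v := by
  have : IsManifold (𝓡 4) 1 M := IsManifold.of_le (n := ∞) (by simp)
  rw [chartDInv_eq_mfderivWithin]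
  exact DFunLike.congr_fun (mfderiv_extChartAt_comp_mfderivWithin_extChartAt_symm hu) v

lemma chartDInv_chartD {P : M} {u : E4} (hu : u ∈ (extChartAt (𝓡 4) P).target) (v : E4) :
    chartDInv P u (chartD P ((extChartAt (𝓡 4) P).symm u) v) = v := by
  have : IsManifold (𝓡 4) 1 M := IsManifold.of_le (n := ∞) (by simp)
  rw [chartDInv_eq_mfderivWithin]
  exact DFunLike.congr_fun (mfderivWithin_extChartAt_symm_comp_mfderiv_extChartAt hu) v

lemma chartDInv_self (P : M) : chartDInv P (extChartAt (𝓡 4) P P) = ContinuousLinearMap.id ℝ E4 := by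
  have : IsManifold (𝓡 4) 1 M := IsManifold.of_le (n := ∞) (by simp)
  rw [chartDInv_eq_mfderivWithin]
  exact mfderivWithin_range_extChartAt_symm

lemma symmL_eq_chartDInv {P x : M} (hx : x ∈ (chartAt E4 P).source) (v : E4) :
    (trivializationAt E4 (TangentSpace (𝓡 4)) P).symm x v = chartDInv P (extChartAt (𝓡 4) P x) v := by
  have : IsManifold (𝓡 4) 1 M := IsManifold.of_le (n := ∞) (by simp)
  rw [chartDInv_eq_mfderivWithin]
  refine (Bundle.Trivialization.symmL_apply (R := ℝ) _ (by simpa using hx) v).symm.trans ?_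
  exact DFunLike.congr_fun (TangentBundle.symmL_trivializationAt (I := 𝓡 4) hx) v

/-- Identifies the bundle trivialization with coordinate expressions, so that smoothness of the
metric as a section becomes smoothness of `coordMetric`. -/
lemma trivialization_bilin {P x : M} (hx : x ∈ (chartAt E4 P).source)
    (B : TangentSpace (𝓡 4) x →L[ℝ] TangentSpace (𝓡 4) x →L[ℝ] ℝ) (v w : E4) :
    (trivializationAt (E4 →L[ℝ] E4 →L[ℝ] ℝ)
      (fun p : M => TangentSpace (𝓡 4) p →L[ℝ] TangentSpace (𝓡 4) p →L[ℝ] ℝ) P ⟨x, B⟩).2 v w =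
      B (chartDInv P (extChartAt (𝓡 4) P x) v) (chartDInv P (extChartAt (𝓡 4) P x) w) := by
  rw [hom_trivializationAt_apply]
  have := inCoordinates_apply_eq₂ (𝕜 := ℝ) (F₁ := E4) (F₂ := E4) (F₃ := ℝ)
    (E₁ := fun p : M => TangentSpace (𝓡 4) p) (E₂ := fun p : M => TangentSpace (𝓡 4) p)
    (E₃ := fun _ : M => ℝ) (x₀ := P) (x := x) (ϕ := B) (v := v) (w := w)
    (by simpa using hx) (by simpa using hx) (by simp)
  refine this.trans ?_
  rw [symmL_eq_chartDInv hx, symmL_eq_chartDInv hx]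
  simp

lemma trivialization_endo {P x : M} (hx : x ∈ (chartAt E4 P).source)
    (B : TangentSpace (𝓡 4) x →L[ℝ] TangentSpace (𝓡 4) x) (v : E4) :
    (trivializationAt (E4 →L[ℝ] E4)
      (fun p : M => TangentSpace (𝓡 4) p →L[ℝ] TangentSpace (𝓡 4) p) P ⟨x, B⟩).2 v =
      chartD P x (B (chartDInv P (extChartAt (𝓡 4) P x) v)) := by
  have : IsManifold (𝓡 4) 1 M := IsManifold.of_le (n := ∞) (by simp)
  rw [hom_trivializationAt_apply]
  have h1 := TangentBundle.continuousLinearMapAt_trivializationAt (I := 𝓡 4) hx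
  have h2 := (Bundle.Trivialization.symmL_apply (R := ℝ) (trivializationAt E4
    (TangentSpace (𝓡 4)) P) (by simpa using hx) v).trans (symmL_eq_chartDInv hx v)
  change (trivializationAt E4 (TangentSpace (𝓡 4)) P).continuousLinearMapAt ℝ x
    (B ((trivializationAt E4 (TangentSpace (𝓡 4)) P).symmL ℝ x v)) = _
  rw [h1, h2]
  rfl

lemma coordMetric_apply (g : NeutralMetric M) (P : M) (u v w : E4) : coordMetric g P u v w =
    g.form ((extChartAt (𝓡 4) P).symm u) (chartDInv P u v) (chartDInv P u w) := rfl

set_option synthInstance.maxHeartbeats 200000 in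
lemma contDiffAt_coordMetric (g : NeutralMetric M) {P : M} {u : E4}
    (hu : u ∈ (extChartAt (𝓡 4) P).target) : ContDiffAt ℝ ∞ (coordMetric g P) u := by
  have hs : (extChartAt (𝓡 4) P).symm u ∈ (chartAt E4 P).source := by
    have := (extChartAt (𝓡 4) P).map_target hu
    rwa [extChartAt_source] at this
  have h1 := (Bundle.Trivialization.contMDiffAt_section_iff (IB := 𝓡 4) (n := ∞)
    (trivializationAt (E4 →L[ℝ] E4 →L[ℝ] ℝ)
      (fun p : M => TangentSpace (𝓡 4) p →L[ℝ] TangentSpace (𝓡 4) p →L[ℝ] ℝ) P)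
      (by simpa using hs)).1 (g.contMDiff ((extChartAt (𝓡 4) P).symm u))
  have h2 : ContMDiffAt 𝓘(ℝ, E4) (𝓡 4) ∞ (extChartAt (𝓡 4) P).symm u :=
    (contMDiffOn_extChartAt_symm P).contMDiffAt ((isOpen_extChartAt_target P).mem_nhds hu)
  have h3 := (h1.comp u h2).contDiffAt
  refine h3.congr_of_eventuallyEq ?_
  filter_upwards [(isOpen_extChartAt_target P).mem_nhds hu] with y hy
  have hys : (extChartAt (𝓡 4) P).symm y ∈ (chartAt E4 P).source := by
    have := (extChartAt (𝓡 4) P).map_target hy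
    rwa [extChartAt_source] at this
  ext v w
  refine Eq.trans ?_ (trivialization_bilin hys (g.val _) v w).symm
  rw [(extChartAt (𝓡 4) P).right_inv hy]
  rfl

lemma isFrame_coordMetric_iff (g : NeutralMetric M) (P : M) (u : E4) (e : Fin 4 → E4) :
    IsFrame (coordMetric g P u).toLinearMap₁₂ e ↔
      IsFrame (g.form ((extChartAt (𝓡 4) P).symm u)) (fun i => chartDInv P u (e i)) := Iff.rfl

lemma isMetricNear_coordMetric (g : NeutralMetric M) {P : M} {u : E4}
    (hu : u ∈ (extChartAt (𝓡 4) P).target) : IsMetricNear (coordMetric g P) u := by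
  filter_upwards [(isOpen_extChartAt_target P).mem_nhds hu] with y hy
  refine ⟨contDiffAt_coordMetric g hy, fun v w => g.symm _ _ _, ?_⟩
  obtain ⟨e, he⟩ := (g.signature ((extChartAt (𝓡 4) P).symm y)).exists_frame
  refine ⟨fun i => chartD P ((extChartAt (𝓡 4) P).symm y) (e i), ?_⟩
  rw [isFrame_coordMetric_iff]
  intro i j
  exact (congrArg₂ (fun v w => g.form ((extChartAt (𝓡 4) P).symm y) v w)
    (chartDInv_chartD hy (e i)) (chartDInv_chartD hy (e j))).trans (he i j)

lemma mdifferentiableAt_extChartAt_symm_of_mem {P : M} {u : E4}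
    (hu : u ∈ (extChartAt (𝓡 4) P).target) :
    MDifferentiableAt 𝓘(ℝ, E4) (𝓡 4) (extChartAt (𝓡 4) P).symm u :=
  ((contMDiffOn_extChartAt_symm (n := ∞) P).contMDiffAt
    ((isOpen_extChartAt_target P).mem_nhds hu)).mdifferentiableAt (by simp)

/-- The coordinate change from the preferred chart around `P` to the one around `Q`. -/
def chartChange (P Q : M) (u : E4) : E4 := extChartAt (𝓡 4) Q ((extChartAt (𝓡 4) P).symm u)

lemma contDiffAt_chartChange {P Q : M} {u : E4} (hu : u ∈ (extChartAt (𝓡 4) P).target)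
    (hQ : (extChartAt (𝓡 4) P).symm u ∈ (extChartAt (𝓡 4) Q).source) :
    ContDiffAt ℝ ∞ (chartChange P Q) u := by
  have h2 : ContMDiffAt 𝓘(ℝ, E4) (𝓡 4) ∞ (extChartAt (𝓡 4) P).symm u :=
    (contMDiffOn_extChartAt_symm P).contMDiffAt ((isOpen_extChartAt_target P).mem_nhds hu)
  have h3 : ContMDiffAt (𝓡 4) 𝓘(ℝ, E4) ∞ (extChartAt (𝓡 4) Q) ((extChartAt (𝓡 4) P).symm u) :=
    contMDiffAt_extChartAt' (by rwa [extChartAt_source] at hQ)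
  exact (h3.comp u h2).contDiffAt

lemma chartDInv_fderiv_chartChange {P Q : M} {u : E4} (hu : u ∈ (extChartAt (𝓡 4) P).target)
    (hQ : (extChartAt (𝓡 4) P).symm u ∈ (extChartAt (𝓡 4) Q).source) (v : E4) :
    chartDInv Q (chartChange P Q u) (fderiv ℝ (chartChange P Q) u v) = chartDInv P u v := by
  have hτ : MDifferentiableAt 𝓘(ℝ, E4) 𝓘(ℝ, E4) (chartChange P Q) u :=
    ((contDiffAt_chartChange hu hQ).differentiableAt (by simp)).mdifferentiableAt
  have hc : mfderiv 𝓘(ℝ, E4) (𝓡 4) ((extChartAt (𝓡 4) Q).symm ∘ chartChange P Q) u =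
      (mfderiv 𝓘(ℝ, E4) (𝓡 4) (extChartAt (𝓡 4) Q).symm (chartChange P Q u)).comp
        (mfderiv 𝓘(ℝ, E4) 𝓘(ℝ, E4) (chartChange P Q) u) :=
    mfderiv_comp u (mdifferentiableAt_extChartAt_symm_of_mem
      ((extChartAt (𝓡 4) Q).map_source hQ)) hτ
  have he : (extChartAt (𝓡 4) Q).symm ∘ chartChange P Q =ᶠ[𝓝 u] (extChartAt (𝓡 4) P).symm := by
    filter_upwards [eventually_mem_source hu hQ] with y hy
    exact (extChartAt (𝓡 4) Q).left_inv hy.2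
  have h1 : (mfderiv 𝓘(ℝ, E4) (𝓡 4) ((extChartAt (𝓡 4) Q).symm ∘ chartChange P Q) u : E4 →L[ℝ] E4)
      = mfderiv 𝓘(ℝ, E4) (𝓡 4) (extChartAt (𝓡 4) P).symm u := he.mfderiv_eq
  rw [mfderiv_eq_fderiv] at hc
  exact (DFunLike.congr_fun (hc.symm.trans h1) v : _)

/-- All tangent spaces are definitionally the model space, so the same `v` and `w` make sense at
both points without transport. -/
lemma form_congr (g : NeutralMetric M) {p q : M} (h : p = q) (v w : E4) :
    g.form p v w = g.form q v w := by subst h; rfl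

/-- The curvature operator may be computed in any of the preferred charts. -/
lemma curvature_chartDInv (g : NeutralMetric M) {P : M} {u : E4}
    (hu : u ∈ (extChartAt (𝓡 4) P).target) (x y z : E4) :
    curvature g ((extChartAt (𝓡 4) P).symm u) (chartDInv P u x) (chartDInv P u y)
      (chartDInv P u z) =
        chartDInv P u (coordCurvature (christoffel (coordMetric g P)) u x y z) := by
  set p := (extChartAt (𝓡 4) P).symm u with hp
  have hQ : (extChartAt (𝓡 4) P).symm u ∈ (extChartAt (𝓡 4) p).source := mem_extChartAt_source p
  -- In the chart preferred at `p` itself, the chart differential at `p` is the identity, so the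
  -- coordinate change and the inverse chart have the same differential.
  have hD (v : E4) : fderiv ℝ (chartChange P p) u v = chartDInv P u v := by
    rw [← chartDInv_fderiv_chartChange hu hQ]
    rw [show chartChange P p u = extChartAt (𝓡 4) p p from rfl, chartDInv_self]
    rfl
  have hev := eventually_mem_source hu hQ
  have key := coordCurvature_naturality (τ := chartChange P p) (G := coordMetric g p)
    (G' := coordMetric g P) (u := u)
    (isMetricNear_coordMetric g ((extChartAt (𝓡 4) p).map_source (mem_extChartAt_source p)))
    (isMetricNear_coordMetric g hu)
    (by filter_upwards [hev] with y hy using contDiffAt_chartChange hy.1 hy.2)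
    (by
      filter_upwards [hev] with y hy v w
      rw [coordMetric_apply, coordMetric_apply, chartDInv_fderiv_chartChange hy.1 hy.2,
        chartDInv_fderiv_chartChange hy.1 hy.2]
      exact form_congr g ((extChartAt (𝓡 4) p).left_inv hy.2).symm _ _)
    (by
      filter_upwards [hev] with y hy
      refine LinearMap.surjective_of_injective (f := (fderiv ℝ (chartChange P p) y).toLinearMap) ?_
      intro v w hvw
      have h1 := chartDInv_fderiv_chartChange hy.1 hy.2 v
      have h2 := chartDInv_fderiv_chartChange hy.1 hy.2 w
      have h3 : fderiv ℝ (chartChange P p) y v = fderiv ℝ (chartChange P p) y w := hvw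
      rw [h3, h2] at h1
      rw [← chartD_chartDInv hy.1 v, ← h1, chartD_chartDInv hy.1 w])
    x y z
  simp only [hD] at key
  exact key.symm

/-! ## Curvature fields in coordinates -/

lemma chartD_chartDInv_of_mem {P x : M} (hx : x ∈ (extChartAt (𝓡 4) P).source) (v : E4) :
    chartD P x (chartDInv P (extChartAt (𝓡 4) P x) v) = v := by
  have h := chartD_chartDInv ((extChartAt (𝓡 4) P).map_source hx) v
  rwa [(extChartAt (𝓡 4) P).left_inv hx] at h

/-- The components of `A` at the point with coordinates `u`, in the frame with coordinates `e`. -/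
def chartComps (g : NeutralMetric M) (A : ∀ p : M, CurvOp (TangentSpace (𝓡 4) p)) (P : M) (u : E4)
    (e : Fin 4 → E4) : Comp :=
  comps (g.form ((extChartAt (𝓡 4) P).symm u)) (A ((extChartAt (𝓡 4) P).symm u))
    (fun i => chartDInv P u (e i))

/-- `A` is a smooth field of algebraic curvature tensors. -/
structure IsCurvatureField (g : NeutralMetric M)
    (A : ∀ p : M, CurvOp (TangentSpace (𝓡 4) p)) : Prop where
  alg : ∀ (p : M) (e : Fin 4 → TangentSpace (𝓡 4) p), IsFrame (g.form p) e →
    IsAlgCurv (comps (g.form p) (A p) e)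
  smooth : ∀ (P : M) (X : E4 → Fin 4 → E4),
    (∀ i, SmoothNear (fun y => X y i) (extChartAt (𝓡 4) P P)) →
    (∀ᶠ y in 𝓝 (extChartAt (𝓡 4) P P), IsFrame (coordMetric g P y).toLinearMap₁₂ (X y)) →
    ∀ a b c d, SmoothNear (fun y => chartComps g A P y (X y) a b c d) (extChartAt (𝓡 4) P P)

lemma chartComps_curvature (g : NeutralMetric M) {P : M} {u : E4}
    (hu : u ∈ (extChartAt (𝓡 4) P).target) (e : Fin 4 → E4) :
    chartComps g (curvature g) P u e = comps (coordMetric g P u).toLinearMap₁₂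
      (coordCurvature (christoffel (coordMetric g P)) u) e := by
  funext a b c d
  exact congrArg (fun w => g.form ((extChartAt (𝓡 4) P).symm u) w (chartDInv P u (e d)))
    (curvature_chartDInv g hu (e a) (e b) (e c))

lemma form_eq_coordMetric (g : NeutralMetric M) (p : M) (v w : E4) :
    g.form p v w = coordMetric g p (extChartAt (𝓡 4) p p) v w := by
  rw [coordMetric_apply, chartDInv_self]
  exact form_congr g (extChartAt_to_inv p).symm v w

lemma isCurvatureField_curvature (g : NeutralMetric M) : IsCurvatureField g (curvature g) where
  alg p e _ := by
    have h := (isMetricNear_coordMetric g (mem_extChartAt_target (I := 𝓡 4) p)).isAlgCurv_comps e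
    convert h using 1
    funext a b c d
    exact form_eq_coordMetric g p _ _
  smooth P X hX hf a b c d := by
    have hm := isMetricNear_coordMetric g (mem_extChartAt_target (I := 𝓡 4) P)
    refine ((hm.smoothNear.clm_apply
      (hm.smoothNear_coordCurvature (hX a) (hX b) (hX c))).clm_apply (hX d)).congr ?_
    filter_upwards [(isOpen_extChartAt_target P).mem_nhds (mem_extChartAt_target (I := 𝓡 4) P)]
      with y hy
    rw [chartComps_curvature g hy]
    rfl

/-- In an orthonormal frame the Weyl components are polynomials in the curvature components. Testing
only orthonormal frames in `IsCurvatureField` is what makes this formula available. -/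
lemma isCurvatureField_weylCurvature (g : NeutralMetric M) :
    IsCurvatureField g (weylCurvature g) where
  alg p e he := by
    rw [weylCurvature, he.comps_weylOp (finrank_tangentSpace p)]
    exact isAlgCurv_weylComp ((isCurvatureField_curvature g).alg p e he)
  smooth P X hX hf a b c d := by
    have hR := (isCurvatureField_curvature g).smooth P X hX hf
    have hs : SmoothNear (fun y => weylComp (chartComps g (curvature g) P y (X y)) a b c d)
        (extChartAt (𝓡 4) P P) := by
      have hc (r : ℝ) := smoothNear_const r (extChartAt (𝓡 4) P P)
      have hric (b d) : SmoothNear (fun y => ricComp (chartComps g (curvature g) P y (X y)) b d)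
          (extChartAt (𝓡 4) P P) :=
        SmoothNear.sum fun i _ => (hc _).mul (hR i b i d)
      have hsc : SmoothNear (fun y => scalComp (chartComps g (curvature g) P y (X y)))
          (extChartAt (𝓡 4) P P) :=
        SmoothNear.sum fun i _ => (hc _).mul (hric i i)
      have hk (i j) := (hric i j).sub (((hsc.mul (hc (24⁻¹ * 6))).mul (hc (δη i j))))
      refine ((hR a b c d).sub ((hsc.mul (hc 24⁻¹)).mul (hc (knComp δη δη a b c d)))).sub
        ((hc (1 / 2)).mul (((((hk a c).mul (hc (δη b d))).add ((hk b d).mul (hc (δη a c)))).sub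
          ((hk a d).mul (hc (δη b c)))).sub ((hk b c).mul (hc (δη a d))))) |>.congr ?_
      refine Eventually.of_forall fun y => ?_
      simp only [weylComp, knComp]
      ring
    refine hs.congr ?_
    filter_upwards [hf] with y hy
    have h := ((isFrame_coordMetric_iff g P y (X y)).1 hy).comps_weylOp
      (finrank_tangentSpace _) (curvature g ((extChartAt (𝓡 4) P).symm y))
    exact congrFun (congrFun (congrFun (congrFun h a) b) c) d

/-! ## Smooth fields of endomorphisms -/

/-- The frame field on a chart domain with the coordinates `X`. -/
def frameField (P : M) (X : E4 → Fin 4 → E4) (p : M) (i : Fin 4) : TangentSpace (𝓡 4) p :=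
  chartDInv P (extChartAt (𝓡 4) P p) (X (extChartAt (𝓡 4) P p) i)

lemma continuous_end (T : E4 →ₗ[ℝ] E4) : Continuous T := T.continuous_of_finiteDimensional

/-- The field of endomorphisms with the constant matrix `N` in the frame field with the
coordinates `X`. -/
def endField (g : NeutralMetric M) (P : M) (X : E4 → Fin 4 → E4) (N : M4) (p : M) :
    TangentSpace (𝓡 4) p →L[ℝ] TangentSpace (𝓡 4) p where
  toLinearMap := frameEnd (g.form p) (frameField P X p) N
  cont := continuous_end (frameEnd (g.form p) (frameField P X p) N)

/-- In the trivialization at `P` the field reads Σ N_ba η_a G(X_a,·) X_b, which is smooth in the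
coordinates. -/
lemma contMDiffAt_endField (g : NeutralMetric M) {P : M} {X : E4 → Fin 4 → E4} (N : M4) {p : M}
    (hp : p ∈ (extChartAt (𝓡 4) P).source)
    (hX : ∀ i, ContDiffAt ℝ ∞ (fun y => X y i) (extChartAt (𝓡 4) P p)) :
    ContMDiffAt (𝓡 4) ((𝓡 4).prod 𝓘(ℝ, E4 →L[ℝ] E4)) ∞
      (fun p => Bundle.TotalSpace.mk' (E4 →L[ℝ] E4)
        (E := fun p : M => TangentSpace (𝓡 4) p →L[ℝ] TangentSpace (𝓡 4) p) p
        (endField g P X N p)) p := by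
  have hp' : p ∈ (chartAt E4 P).source := by rwa [extChartAt_source] at hp
  rw [Bundle.Trivialization.contMDiffAt_section_iff (IB := 𝓡 4) (n := ∞)
    (trivializationAt (E4 →L[ℝ] E4)
      (fun p : M => TangentSpace (𝓡 4) p →L[ℝ] TangentSpace (𝓡 4) p) P)
      (by simpa using hp')]
  have hc : ContDiffAt ℝ ∞ (fun u => ∑ a, ∑ b, (N b a * η a) •
      (coordMetric g P u (X u a)).smulRight (X u b)) (extChartAt (𝓡 4) P p) := by
    have hG := contDiffAt_coordMetric g ((extChartAt (𝓡 4) P).map_source hp)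
    refine ContDiffAt.sum fun a _ => ContDiffAt.sum fun b _ => ContDiffAt.const_smul _ ?_
    exact (hG.clm_apply (hX a)).smulRight (hX b)
  have h := hc.contMDiffAt.comp p (contMDiffAt_extChartAt' (n := ∞) hp')
  refine h.congr_of_eventuallyEq ?_
  filter_upwards [(isOpen_extChartAt_source P).mem_nhds hp] with x hx
  ext1 v
  refine (trivialization_endo (by rwa [extChartAt_source] at hx) (endField g P X N x) v).trans ?_
  have h1 : endField g P X N x (chartDInv P (extChartAt (𝓡 4) P x) v) =
      ∑ a, ∑ b, (N b a * η a * coordMetric g P (extChartAt (𝓡 4) P x)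
        (X (extChartAt (𝓡 4) P x) a) v) •
          chartDInv P (extChartAt (𝓡 4) P x) (X (extChartAt (𝓡 4) P x) b) := by
    refine (frameEnd_apply (g.form x) (frameField P X x) N
      (chartDInv P (extChartAt (𝓡 4) P x) v)).trans ?_
    refine Finset.sum_congr rfl fun a _ => Finset.sum_congr rfl fun b _ => ?_
    rw [coordMetric_apply, form_congr g ((extChartAt (𝓡 4) P).left_inv hx)]
    rfl
  rw [h1]
  simp only [map_sum, map_smul, chartD_chartDInv_of_mem hx, Function.comp_apply, sum_apply,
    smul_apply, ContinuousLinearMap.smulRight_apply, smul_smul]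

end Coordinates

/-! ## Rotations fixing the first frame vector -/

lemma adj_apply (X : M4) (i j : Fin 4) : adj X i j = η i * X j i * η j := by
  simp [adj, H, Matrix.mul_diagonal, Matrix.diagonal_mul]

lemma commute_proj₀_iff {X : M4} :
    Commute proj₀ X ↔ ∀ i, i ≠ 0 → X i 0 = 0 ∧ X 0 i = 0 := by
  have h1 (i j) : (proj₀ * X) i j = if i = 0 then X 0 j else 0 := by
    by_cases hi : i = 0
    · subst hi; simp [proj₀]
    · simp [proj₀, hi, Matrix.single_mul_apply_of_ne]
  have h2 (i j) : (X * proj₀) i j = if j = 0 then X i 0 else 0 := by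
    by_cases hj : j = 0
    · subst hj; simp [proj₀]
    · simp [proj₀, hj, Matrix.mul_single_apply_of_ne]
  constructor
  · intro h i hi
    have e1 := congrFun (congrFun h.eq i) 0
    have e2 := congrFun (congrFun h.eq 0) i
    rw [h1, h2] at e1 e2
    simp only [hi, if_true, if_false] at e1 e2
    exact ⟨e1.symm, e2⟩
  · intro h
    change proj₀ * X = X * proj₀
    ext i j
    rw [h1, h2]
    by_cases hi : i = 0 <;> by_cases hj : j = 0
    · simp [hi, hj]
    · simp [hi, hj, (h j hj).2]
    · simp [hi, hj, (h i hi).1]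
    · simp [hi, hj]

lemma adj_jac_e0 {R : Comp} (hR : IsAlgCurv R) : adj (jac R ![1, 0, 0, 0]) = jac R ![1, 0, 0, 0] := by
  ext l k
  have h : R l 0 0 k = R k 0 0 l := by
    linarith [hR.pair l 0 0 k, hR.anti₁ 0 k l 0, hR.anti₁ k 0 l 0, hR.anti₂ l 0 k 0,
      hR.anti₂ 0 l k 0]
  rw [adj_apply, jac_e0, jac_e0, h]
  linear_combination (η l * R k 0 0 l) * η_mul_self k

/-- J(x) kills x and has image orthogonal to x. -/
lemma commute_proj₀_jac_e0 {R : Comp} (hR : IsAlgCurv R) : Commute proj₀ (jac R ![1, 0, 0, 0]) := by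
  refine commute_proj₀_iff.2 fun i _ => ?_
  rw [jac_e0, jac_e0, hR.diag₁, hR.diag₂]
  simp

/-- Commuting with the projection means that T sends the first frame vector to ± itself. J is
quadratic in that vector, so the sign drops out and only conjugation by T, whose inverse is its
adjoint, remains. -/
lemma jac_transformComp_e0 {T : M4} (hT : T.transpose * H * T = H) (hc : Commute proj₀ T)
    (R : Comp) : jac (transformComp T R) ![1, 0, 0, 0] = adj T * jac R ![1, 0, 0, 0] * T := by
  have h0 := commute_proj₀_iff.1 hc
  have ht : T 0 0 * T 0 0 = 1 := by
    have h := congrFun (congrFun hT 0) 0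
    simp only [H, Matrix.mul_apply, Matrix.transpose_apply, Matrix.diagonal_apply,
      Fin.sum_univ_four, (h0 1 (by decide)).1, (h0 2 (by decide)).1, (h0 3 (by decide)).1] at h
    simp at h
    linarith
  have hcol (i) : T i 0 = if i = 0 then T 0 0 else 0 := by
    split_ifs with h
    · rw [h]
    · exact (h0 i h).1
  ext l k
  have hR : transformComp T R k 0 0 l = ∑ d, ∑ a, T d l * (T a k * R a 0 0 d) := by
    simp only [transformComp]
    refine Finset.sum_congr rfl fun d _ => ?_
    rw [Finset.sum_eq_single 0 (fun c _ hc => by simp [(h0 c hc).1]) (by simp),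
      Finset.sum_eq_single 0 (fun c _ hc => by simp [(h0 c hc).1]) (by simp)]
    refine Finset.sum_congr rfl fun a _ => ?_
    linear_combination (T d l * (T a k * R a 0 0 d)) * ht
  rw [jac_e0, hR, Finset.sum_comm, Finset.mul_sum, Matrix.mul_apply]
  refine Finset.sum_congr rfl fun a _ => ?_
  rw [Matrix.mul_apply, Finset.mul_sum, Finset.sum_mul]
  refine Finset.sum_congr rfl fun d _ => ?_
  rw [adj_apply, jac_e0]
  linear_combination (-(η l * T d l * T a k * R a 0 0 d)) * η_mul_self d

lemma adj_mul_self {T : M4} (hT : T.transpose * H * T = H) : adj T * T = 1 := by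
  rw [adj, mul_assoc, mul_assoc, ← mul_assoc T.transpose, hT, H_mul_H]

lemma IsFrame.gram {V : Type*} [AddCommGroup V] [Module ℝ V] {g : LinearMap.BilinForm ℝ V}
    {e : Fin 4 → V} (he : IsFrame g e) : (Matrix.of fun i j => g (e i) (e j)) = H := by
  ext i j
  rw [Matrix.of_apply, he i j, H, Matrix.diagonal_apply]

lemma gram_change {V : Type*} [AddCommGroup V] [Module ℝ V] (g : LinearMap.BilinForm ℝ V)
    (e : Fin 4 → V) (T : M4) : T.transpose * (Matrix.of fun i j => g (e i) (e j)) * T =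
      Matrix.of fun i j => g ((fun a => ∑ b, T b a • e b) i) ((fun a => ∑ b, T b a • e b) j) := by
  ext i j
  simp only [Matrix.mul_apply, Matrix.transpose_apply, Matrix.of_apply, map_sum, map_smul,
    LinearMap.sum_apply, LinearMap.smul_apply, smul_eq_mul, Finset.mul_sum, Finset.sum_mul]
  refine Finset.sum_congr rfl fun a _ => Finset.sum_congr rfl fun b _ => ?_
  ring

/-- Any two orthonormal frames differ by a pseudo-orthogonal matrix. -/
lemma IsFrame.exists_change {V : Type*} [AddCommGroup V] [Module ℝ V]
    {g : LinearMap.BilinForm ℝ V} {e f : Fin 4 → V} (hV : Module.finrank ℝ V = 4)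
    (he : IsFrame g e) (hf : IsFrame g f) :
    ∃ T : M4, T.transpose * H * T = H ∧ f = fun a => ∑ b, T b a • e b := by
  have hexp : f = fun a => ∑ b, (η b * g (f a) (e b)) • e b := by
    funext a
    exact he.expand hV (f a)
  refine ⟨Matrix.of fun b a => η b * g (f a) (e b), ?_, hexp⟩
  rw [← he.gram, gram_change]
  exact (congrArg (fun f' : Fin 4 → V => Matrix.of fun i j => g (f' i) (f' j))
    hexp.symm).trans (hf.gram.trans he.gram.symm)

/-! ## Curvature homogeneity -/

section Homogeneity

variable {M : Type*} [TopologicalSpace M] [ChartedSpace E4 M] [IsManifold (𝓡 4) ∞ M]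
  {g : NeutralMetric M} {A : ∀ p : M, CurvOp (TangentSpace (𝓡 4) p)}

lemma JordanFormIndependent.exists_similarity (h : JordanFormIndependent g A) {p q : M}
    {e : Fin 4 → TangentSpace (𝓡 4) p} {f : Fin 4 → TangentSpace (𝓡 4) q}
    (he : IsFrame (g.form p) e) (hf : IsFrame (g.form q) f) {x y : Fin 4 → ℝ} (hx : qf x = -1)
    (hy : qf y = -1) : ∃ Q : M4, IsUnit Q ∧
      jac (comps (g.form p) (A p) e) x * Q = Q * jac (comps (g.form q) (A q) f) y := by
  obtain ⟨N, hN⟩ := h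
  have h1 := hN p (∑ i, x i • e i) (by rw [he.form_self, hx])
  have h2 := hN q (∑ i, y i • f i) (by rw [hf.form_self, hy])
  obtain ⟨Q, hQ, hQ'⟩ := h1.exists_similarity h2 (he.basis (finrank_tangentSpace p))
    (hf.basis (finrank_tangentSpace q))
  rw [he.toMatrix_jacobiOp, hf.toMatrix_jacobiOp] at hQ'
  exact ⟨Q, hQ, hQ'⟩

lemma trace_eq_of_similar {X Y Q : M4} (hQ : IsUnit Q) (h : X * Q = Q * Y) :
    X.trace = Y.trace := by
  obtain ⟨Q, rfl⟩ := hQ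
  have : X = Q * Y * ((Q⁻¹ : M4ˣ) : M4) := by
    rw [← h, Units.mul_inv_cancel_right]
  rw [this, mul_assoc, Matrix.trace_mul_comm, mul_assoc, Units.inv_mul, mul_one]

lemma JordanFormIndependent.exists_isHalfFlat (h : JordanFormIndependent g A)
    (hA : IsCurvatureField g A) {p : M} {e : Fin 4 → TangentSpace (𝓡 4) p}
    (he : IsFrame (g.form p) e) :
    ∃ s : ℝ, (s = 1 ∨ s = -1) ∧ IsHalfFlat s (comps (g.form p) (A p) e) := by
  have h0 : qf ![1, 0, 0, 0] = -1 := by simp [qf]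
  refine Neutral.exists_isHalfFlat (hA.alg p e he)
    (c₁ := (jac (comps (g.form p) (A p) e) ![1, 0, 0, 0]).trace)
    (c₂ := (jac (comps (g.form p) (A p) e) ![1, 0, 0, 0] *
      jac (comps (g.form p) (A p) e) ![1, 0, 0, 0]).trace) (fun x hx => ?_) (fun x hx => ?_)
  · obtain ⟨Q, hQ, hQ'⟩ := h.exists_similarity he he hx h0
    exact trace_eq_of_similar hQ hQ'
  · obtain ⟨Q, hQ, hQ'⟩ := h.exists_similarity he he hx h0
    refine trace_eq_of_similar hQ ?_
    rw [mul_assoc, hQ', ← mul_assoc, hQ', mul_assoc]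

lemma chartComps_change (P : M) (u : E4) (e : Fin 4 → E4) (T : M4) :
    chartComps g A P u (fun a => ∑ b, T b a • e b) = transformComp T (chartComps g A P u e) := by
  refine Eq.trans ?_ (comps_change (g.form ((extChartAt (𝓡 4) P).symm u))
    (A ((extChartAt (𝓡 4) P).symm u)) (fun i => chartDInv P u (e i)) T)
  refine congrArg (comps _ _) (funext fun a => ?_)
  exact (map_sum (chartDInv P u) _ _).trans (Finset.sum_congr rfl fun b _ => map_smul _ _ _)

lemma comps_point_congr {p q : M} (h : q = p) (f : Fin 4 → E4) :
    comps (g.form q) (A q) f = comps (g.form p) (A p) f := by subst h; rfl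

lemma chartComps_extChartAt {P p : M} (hp : p ∈ (extChartAt (𝓡 4) P).source)
    (X : E4 → Fin 4 → E4) : chartComps g A P (extChartAt (𝓡 4) P p) (X (extChartAt (𝓡 4) P p)) =
      comps (g.form p) (A p) (frameField P X p) :=
  comps_point_congr ((extChartAt (𝓡 4) P).left_inv hp) _

lemma isFrame_frameField {P p : M} (hp : p ∈ (extChartAt (𝓡 4) P).source) {X : E4 → Fin 4 → E4}
    (h : IsFrame (coordMetric g P (extChartAt (𝓡 4) P p)).toLinearMap₁₂
      (X (extChartAt (𝓡 4) P p))) : IsFrame (g.form p) (frameField P X p) := fun i j =>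
  (form_congr g ((extChartAt (𝓡 4) P).left_inv hp) _ _).symm.trans (h i j)

lemma frameField_self (P : M) (X : E4 → Fin 4 → E4) :
    frameField P X P = X (extChartAt (𝓡 4) P P) := by
  funext i
  exact DFunLike.congr_fun (chartDInv_self P) (X (extChartAt (𝓡 4) P P) i)

/-- Every orthonormal frame at a point extends to a smooth orthonormal frame field in which the
components of `A` are constant. -/
lemma JordanFormIndependent.exists_frameField (h : JordanFormIndependent g A)
    (hA : IsCurvatureField g A) {P : M} {e : Fin 4 → TangentSpace (𝓡 4) P}
    (he : IsFrame (g.form P) e) : ∃ X : E4 → Fin 4 → E4,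
      (∀ i, SmoothNear (fun y => X y i) (extChartAt (𝓡 4) P P)) ∧
      (∀ᶠ y in 𝓝 (extChartAt (𝓡 4) P P), IsFrame (coordMetric g P y).toLinearMap₁₂ (X y)) ∧
      ∀ᶠ y in 𝓝 (extChartAt (𝓡 4) P P),
        chartComps g A P y (X y) = comps (g.form P) (A P) e := by
  set u₀ := extChartAt (𝓡 4) P P with hu₀
  have hPs := mem_extChartAt_source (I := 𝓡 4) P
  have he' : IsFrame (coordMetric g P u₀).toLinearMap₁₂ (e : Fin 4 → E4) := fun i j =>
    (form_eq_coordMetric g P (e i) (e j)).symm.trans (he i j)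
  obtain ⟨X, hXs, hX0, hXf⟩ :=
    (isMetricNear_coordMetric g (mem_extChartAt_target (I := 𝓡 4) P)).exists_smooth_frame he'
  have hRs := hA.smooth P X hXs hXf
  have hC : chartComps g A P u₀ (X u₀) = comps (g.form P) (A P) e := by
    rw [chartComps_extChartAt hPs, frameField_self, hX0]
  have hfr : ∀ y, IsFrame (coordMetric g P y).toLinearMap₁₂ (X y) →
      IsAlgCurv (chartComps g A P y (X y)) := fun y hy =>
    hA.alg _ _ ((isFrame_coordMetric_iff g P y (X y)).1 hy)
  have hq : qf ![1, 0, 0, 0] = -1 := by simp [qf]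
  obtain ⟨T, hTs, hT0, hTH, hTJ, hTc⟩ := exists_smooth_conjugation
    (J := fun y => jac (chartComps g A P y (X y)) ![1, 0, 0, 0]) (x := u₀)
    (smoothNear_matrix.2 fun l k => by
      simp only [jac_e0]
      exact (smoothNear_const _ _).mul (hRs k 0 0 l))
    (hXf.mono fun y hy => adj_jac_e0 (hfr y hy))
    (hXf.mono fun y hy => commute_proj₀_jac_e0 (hfr y hy))
    (hXf.mono fun y hy => h.exists_similarity ((isFrame_coordMetric_iff g P y (X y)).1 hy)
      ((isFrame_coordMetric_iff g P u₀ (X u₀)).1 hXf.self_of_nhds) hq hq)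
  have hYs (a) : SmoothNear (fun y => ∑ b, T y b a • X y b) u₀ :=
    SmoothNear.sum fun b _ => (smoothNear_matrix.1 hTs b a).smul (hXs b)
  have hYf : ∀ᶠ y in 𝓝 u₀, IsFrame (coordMetric g P y).toLinearMap₁₂
      (fun a => ∑ b, T y b a • X y b) := by
    filter_upwards [hXf, hTH] with y h1 h2
    exact isFrame_of_transpose (by rw [h1.gram, h2])
  have hY0 : (fun a => ∑ b, T u₀ b a • X u₀ b) = X u₀ := by
    funext a
    simp [hT0, Matrix.one_apply]
  refine ⟨fun y a => ∑ b, T y b a • X y b, hYs, hYf, ?_⟩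
  have hSs := hA.smooth P (fun y a => ∑ b, T y b a • X y b) hYs hYf
  have hcont : ContinuousAt (fun y => chartComps g A P y (fun a => ∑ b, T y b a • X y b)) u₀ :=
    continuousAt_pi.2 fun a => continuousAt_pi.2 fun b => continuousAt_pi.2 fun c =>
      continuousAt_pi.2 fun d => (hSs a b c d).continuousAt
  -- Half flatness of a given orientation is closed, so an orientation that fails at `u₀` fails
  -- nearby. Any orientation occurring at a nearby point is therefore also valid at `u₀`, and the
  -- two tensors can be compared.
  have hflat (s : ℝ) : ∀ᶠ y in 𝓝 u₀,
      IsHalfFlat s (chartComps g A P y (fun a => ∑ b, T y b a • X y b)) →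
        IsHalfFlat s (chartComps g A P u₀ (X u₀)) := by
    by_cases hs : IsHalfFlat s (chartComps g A P u₀ (X u₀))
    · exact Eventually.of_forall fun _ _ => hs
    · have := hcont.eventually ((isClosed_isHalfFlat s).isOpen_compl.mem_nhds
        (show _ ∈ {R | IsHalfFlat s R}ᶜ by simp only [hY0]; exact hs))
      filter_upwards [this] with y hy h1 using absurd h1 hy
  filter_upwards [hXf, hYf, hTH, hTJ, hTc, hflat 1, hflat (-1)] with y h1 h2 h3 h4 h5 h6 h7
  have halg := hfr y h1
  obtain ⟨s, hs, hsy⟩ := h.exists_isHalfFlat hA ((isFrame_coordMetric_iff g P y _).1 h2)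
  have hs0 : IsHalfFlat s (chartComps g A P u₀ (X u₀)) := by
    rcases hs with rfl | rfl
    · exact h6 hsy
    · exact h7 hsy
  rw [← hC]
  refine hsy.eq_of_jac_eq (hA.alg _ _ ((isFrame_coordMetric_iff g P y _).1 h2))
    (hfr u₀ hXf.self_of_nhds) hs0 ?_
  -- In the rotated frame the Jacobi matrix is T* J(y) T = T* T J(u₀) = J(u₀).
  rw [chartComps_change, jac_transformComp_e0 h3 h5, mul_assoc, h4, ← mul_assoc,
    adj_mul_self h3, one_mul]

/-! ### A single algebraic model on a connected manifold -/

/-- The points at which `A` has the components `C` in some orthonormal frame. -/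
def modelSet (g : NeutralMetric M) (A : ∀ p : M, CurvOp (TangentSpace (𝓡 4) p)) (C : Comp) :
    Set M :=
  {p | ∃ e : Fin 4 → TangentSpace (𝓡 4) p, IsFrame (g.form p) e ∧ comps (g.form p) (A p) e = C}

lemma JordanFormIndependent.isOpen_modelSet (h : JordanFormIndependent g A)
    (hA : IsCurvatureField g A) (C : Comp) : IsOpen (modelSet g A C) := by
  rw [isOpen_iff_mem_nhds]
  rintro P ⟨e, he, rfl⟩
  obtain ⟨X, -, hXf, hXC⟩ := h.exists_frameField hA he
  have hc := (continuousAt_extChartAt (I := 𝓡 4) P).eventually (hXf.and hXC)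
  filter_upwards [hc, (isOpen_extChartAt_source (I := 𝓡 4) P).mem_nhds
    (mem_extChartAt_source (I := 𝓡 4) P)] with p hp hps
  exact ⟨frameField P X p, isFrame_frameField hps hp.1, by
    rw [← chartComps_extChartAt hps, hp.2]⟩

/-- The matrix relating the two frames at `p` has constant entries, so it performs the same change
of components at every other point. By symmetry, model sets that meet are equal. -/
lemma modelSet_subset_of_mem {C D : Comp} {p : M} (hC : p ∈ modelSet g A C)
    (hD : p ∈ modelSet g A D) : modelSet g A C ⊆ modelSet g A D := by
  obtain ⟨e, he, rfl⟩ := hC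
  obtain ⟨f, hf, rfl⟩ := hD
  obtain ⟨T, hT, rfl⟩ := he.exists_change (finrank_tangentSpace p) hf
  rintro q ⟨e', he', hq⟩
  refine ⟨fun a => ∑ b, T b a • e' b, isFrame_of_transpose (by rw [he'.gram, hT]), ?_⟩
  rw [comps_change, comps_change, hq]

lemma JordanFormIndependent.modelSet_eq_univ [PreconnectedSpace M] (h : JordanFormIndependent g A)
    (hA : IsCurvatureField g A) {C : Comp} (hC : (modelSet g A C).Nonempty) :
    modelSet g A C = Set.univ := by
  refine IsClopen.eq_univ ⟨⟨?_⟩, h.isOpen_modelSet hA C⟩ hC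
  rw [isOpen_iff_mem_nhds]
  intro p hp
  obtain ⟨e, he⟩ := (g.signature p).exists_frame
  have hpD : p ∈ modelSet g A (comps (g.form p) (A p) e) := ⟨e, he, rfl⟩
  -- The open model set of a point outside cannot meet the given one, so the complement is open.
  filter_upwards [(h.isOpen_modelSet hA _).mem_nhds hpD] with q hqD hqC
  exact hp (modelSet_subset_of_mem hqD hqC hpD)

/-- Jordan Osserman fields of algebraic curvature tensors are modified Clifford. -/
lemma JordanFormIndependent.exists_cliffordDecomposition [ConnectedSpace M]
    (h : JordanFormIndependent g A) (hA : IsCurvatureField g A) :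
    ∃ (s : ℝ) (C : Comp), (modelSet g A C).Nonempty ∧
      HasConstantCliffordDecomposition g A 0 (cliffDiag C) (cliffOff s C) := by
  obtain ⟨p₀⟩ := (inferInstance : Nonempty M)
  obtain ⟨e₀, he₀⟩ := (g.signature p₀).exists_frame
  obtain ⟨s, hs, hflat⟩ := h.exists_isHalfFlat hA he₀
  set C := comps (g.form p₀) (A p₀) e₀
  have hne : (modelSet g A C).Nonempty := ⟨p₀, e₀, he₀, rfl⟩
  refine ⟨s, C, hne, fun P => ?_⟩
  obtain ⟨e, he, heC⟩ : P ∈ modelSet g A C := by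
    rw [h.modelSet_eq_univ hA hne]; trivial
  obtain ⟨X, hXs, hXf, hXC⟩ := h.exists_frameField hA he
  obtain ⟨V, hV, hVo, hPV⟩ := eventually_nhds_iff.1
    ((eventually_all.2 hXs).and (hXf.and hXC))
  refine ⟨(extChartAt (𝓡 4) P).source ∩ extChartAt (𝓡 4) P ⁻¹' V,
    (continuousOn_extChartAt P).isOpen_inter_preimage (isOpen_extChartAt_source P) hVo,
    ⟨mem_extChartAt_source P, hPV⟩, fun i => endField g P X (cliffMat s i), ⟨?_, ?_⟩, ?_⟩
  · exact fun i p hp => (contMDiffAt_endField g (cliffMat s i) hp.1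
      (hV _ hp.2).1).contMDiffWithinAt
  · exact fun p hp => (isFrame_frameField hp.1 (hV _ hp.2).2.1).isCliff11Structure
      (finrank_tangentSpace p) hs
  · intro p hp x y z
    have hf := isFrame_frameField hp.1 (hV _ hp.2).2.1
    have hc : comps (g.form p) (A p) (frameField P X p) = C := by
      rw [← chartComps_extChartAt hp.1, (hV _ hp.2).2.2, heC]
    have := hf.eq_modifiedClifford (finrank_tangentSpace p) hs (hA.alg p _ hf)
      (by rw [hc]; exact hflat) x y z
    rw [hc] at this
    exact this

end Homogeneity

end Neutral

end

/-! ### The theorem for the curvature and for the Weyl tensor -/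

theorem theorem1p5 {M : Type*} [TopologicalSpace M] [ChartedSpace Neutral.E4 M]
    [IsManifold (𝓡 4) ∞ M] [ConnectedSpace M] (g : Neutral.NeutralMetric M) :
    (Neutral.GloballyJordanOsserman g →
      ∃ (l₀ : ℝ) (l : Fin 3 → ℝ) (m : Fin 3 → Fin 3 → ℝ),
        Neutral.HasConstantCliffordDecomposition g (Neutral.curvature g) l₀ l m) ∧
    (Neutral.GloballyConformallyJordanOsserman g →
      ∃ (l₀ : ℝ) (l : Fin 3 → ℝ) (m : Fin 3 → Fin 3 → ℝ),
        l₀ - l 0 + l 1 + l 2 = 0 ∧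
        Neutral.HasConstantCliffordDecomposition g (Neutral.weylCurvature g) l₀ l m) := by
  constructor
  · intro h
    obtain ⟨s, C, -, hC⟩ := Neutral.JordanFormIndependent.exists_cliffordDecomposition h
      (Neutral.isCurvatureField_curvature g)
    exact ⟨_, _, _, hC⟩
  · intro h
    obtain ⟨s, C, ⟨p, e, he, rfl⟩, hC⟩ :=
      Neutral.JordanFormIndependent.exists_cliffordDecomposition h
        (Neutral.isCurvatureField_weylCurvature g)
    refine ⟨_, _, _, ?_, hC⟩
    have hR := (Neutral.isCurvatureField_curvature g).alg p e he
    -- With λ₀ = 0 and the coefficients from `cliffDiag`, the required sum is -1/3 of the (0,0)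
    -- Ricci component of the Weyl tensor, which vanishes.
    have hw := Neutral.ricComp_weylComp hR
    have hW := Neutral.isAlgCurv_weylComp hR
    rw [Neutral.weylCurvature, he.comps_weylOp (Neutral.finrank_tangentSpace p)]
    simp only [Neutral.ricComp, Fin.sum_univ_four, Neutral.η_zero, Neutral.η_one, Neutral.η_two,
      Neutral.η_three, hW.diag₁, hW.anti₁ 0 1, hW.anti₁ 0 2, hW.anti₁ 0 3, hW.anti₂ 0 1,
      hW.anti₂ 0 2, hW.anti₂ 0 3] at hw
    simp only [Neutral.cliffDiag, Matrix.cons_val_zero, Matrix.cons_val_one, Matrix.cons_val]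
    linarith
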